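/- Let $p\ge 3$ and $q$ be prime numbers, let $E=\operatorname{diag}(1,p)$ and $\Lambda=\begin{pmatrix}0&E\\-E&0\end{pmatrix}$, and let $$\tilde\Gamma_{1,p}(q)=\{\gamma\in \mathrm{GL}(4,\mathbb Z)\mid \gamma\Lambda\,{}^t\gamma=\Lambda,\ \gamma\equiv \mathbf 1 \bmod q\}.$$ This group acts on the row vectors of $\mathbb Q^4$ by $v\mapsto v\gamma$, and hence on the set of nonzero subspaces of $\mathbb Q^4$ that are totally isotropic for $\Lambda$; write $\Gamma=\tilde\Gamma_{1,p}(q)$. The Tits building $\mathcal T(\Gamma)$ is the graph whose vertices are the $\Gamma$-orbits of these subspaces, the distinct orbits of $U_1$ and $U_2$ being joined by an edge if and only if $U_1\gamma\subseteq U_2$ or $U_2\subseteq U_1\gamma$ for some $\gamma\in\Gamma$. Then the number of $\Gamma$-orbits of isotropic planes (two-dimensional isotropic subspaces) is exactly $$\frac{q^4-1}{2}\ \text{ if } q\ne p,2;\qquad \frac{(q^2-1)(q^2+q)}{2}\ \text{ if } q=p;\qquad 15\ \text{ if } q=2.$$ Moreover, $\mathcal T(\Gamma)$ is an $(a_b,c_d)$-configuration: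 every vertex is either an orbit of one-dimensional isotropic subspaces or an orbit of isotropic planes (not both), every edge joins an orbit of one of these kinds to an orbit of the other kind, there are exactly $a$ orbits of one-dimensional isotropic subspaces, each adjacent to exactly $b$ orbits of isotropic planes, and there are exactly $c$ orbits of isotropic planes, each adjacent to exactly $d$ orbits of one-dimensional isotropic subspaces, where $$(a,b,c,d)=\begin{cases}\left(q^4-1,\ \tfrac{q^2-1}{2},\ \tfrac{q^4-1}{2},\ q^2-1\right)& \text{if } q\ne p,2,\\[2pt] \left(q^4-q^2,\ \tfrac{q^2-1}{2},\ \tfrac{(q^2-1)(q^2+q)}{2},\ q^2-q\right)&\text{if } q=p,\\[2pt] (30,\ 3,\ 15,\ 6)&\text{if } q=2.\end{cases}$$ -/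

import Mathlib

namespace SiegelTits

/-- The alternating form `Λ = (0 E; -E 0)` with `E = diag(1, t)`, as an integral matrix. -/
def formMatrix (t : ℕ) : Matrix (Fin 4) (Fin 4) ℤ :=
  !![0, 0, 1, 0;
     0, 0, 0, (t : ℤ);
     -1, 0, 0, 0;
     0, -(t : ℤ), 0, 0]

/-- The symplectic group `Sp(Λ, ℤ) = {γ ∈ GL(4, ℤ) | γ Λ γᵀ = Λ}` of the form `Λ`. -/
def symplecticGroup (t : ℕ) : Subgroup (Matrix.GeneralLinearGroup (Fin 4) ℤ) where
  carrier := {γ | γ.val * formMatrix t * γ.val.transpose = formMatrix t}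
  one_mem' := by simp
  mul_mem' := by
    intro a b ha hb
    simp only [Set.mem_ofPred_eq, Units.val_mul, Matrix.transpose_mul] at *
    calc a.val * b.val * formMatrix t * (b.val.transpose * a.val.transpose)
        = a.val * (b.val * formMatrix t * b.val.transpose) * a.val.transpose := by
          simp only [Matrix.mul_assoc]
      _ = formMatrix t := by rw [hb, ha]
  inv_mem' := by
    intro a ha
    simp only [Set.mem_ofPred_eq] at *
    have h1 : (a⁻¹).val * a.val = 1 := by
      rw [← Units.val_mul]; simp
    have h2 : a.val.transpose * (a⁻¹).val.transpose = 1 := by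
      rw [← Matrix.transpose_mul, h1, Matrix.transpose_one]
    calc (a⁻¹).val * formMatrix t * (a⁻¹).val.transpose
        = (a⁻¹).val * (a.val * formMatrix t * a.val.transpose) * (a⁻¹).val.transpose := by
          rw [ha]
      _ = ((a⁻¹).val * a.val) * formMatrix t * (a.val.transpose * (a⁻¹).val.transpose) := by
          simp only [Matrix.mul_assoc]
      _ = formMatrix t := by rw [h1, h2]; simp

/-- The group of all `γ ∈ Sp(Λ, ℤ)` with `γ ≡ 1` modulo `n`: the kernel of the reduction
`Sp(Λ, ℤ) → GL(4, ℤ/n)`. -/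
def levelGroup (t n : ℕ) : Subgroup (Matrix.GeneralLinearGroup (Fin 4) ℤ) :=
  symplecticGroup t ⊓
    (Matrix.GeneralLinearGroup.map (n := Fin 4) (Int.castRingHom (ZMod n))).ker

/-- The subspace `U · γ`, where `γ` acts on the row vectors of `ℚ⁴` by `v ↦ v · γ`. -/
def act (γ : Matrix.GeneralLinearGroup (Fin 4) ℤ) (U : Submodule ℚ (Fin 4 → ℚ)) :
    Submodule ℚ (Fin 4 → ℚ) :=
  U.map (Matrix.vecMulLinear (γ.val.map (Int.cast : ℤ → ℚ)))

theorem act_one (U : Submodule ℚ (Fin 4 → ℚ)) : act 1 U = U := by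
  have h : Matrix.vecMulLinear
      ((1 : Matrix.GeneralLinearGroup (Fin 4) ℤ).val.map (Int.cast : ℤ → ℚ)) =
      LinearMap.id := by
    apply LinearMap.ext
    intro v
    simp only [Matrix.vecMulLinear_apply, Units.val_one, LinearMap.id_apply]
    rw [Matrix.map_one _ Int.cast_zero Int.cast_one, Matrix.vecMul_one]
  rw [act, h, Submodule.map_id]

theorem act_mul (γ δ : Matrix.GeneralLinearGroup (Fin 4) ℤ) (U : Submodule ℚ (Fin 4 → ℚ)) :
    act (γ * δ) U = act δ (act γ U) := by
  have hm : (γ * δ).val.map (Int.cast : ℤ → ℚ) =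
      γ.val.map (Int.cast : ℤ → ℚ) * δ.val.map (Int.cast : ℤ → ℚ) := by
    rw [Units.val_mul]
    exact Matrix.map_mul (f := Int.castRingHom ℚ)
  have h : Matrix.vecMulLinear ((γ * δ).val.map (Int.cast : ℤ → ℚ)) =
      (Matrix.vecMulLinear (δ.val.map (Int.cast : ℤ → ℚ))).comp
        (Matrix.vecMulLinear (γ.val.map (Int.cast : ℤ → ℚ))) := by
    apply LinearMap.ext
    intro v
    simp only [LinearMap.comp_apply, Matrix.vecMulLinear_apply, hm, Matrix.vecMul_vecMul]
  rw [act, h, Submodule.map_comp, act, act]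

theorem act_mono (γ : Matrix.GeneralLinearGroup (Fin 4) ℤ) {U W : Submodule ℚ (Fin 4 → ℚ)}
    (h : U ≤ W) : act γ U ≤ act γ W :=
  Submodule.map_mono h

/-- `U` is (totally) isotropic for `Λ`. -/
def IsIsotropic (t : ℕ) (U : Submodule ℚ (Fin 4 → ℚ)) : Prop :=
  ∀ v ∈ U, ∀ w ∈ U, v ⬝ᵥ ((formMatrix t).map (Int.cast : ℤ → ℚ)).mulVec w = 0

/-- The nontrivial isotropic subspaces of `ℚ⁴`. -/
abbrev IsotropicSubspace (t : ℕ) : Type :=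
  {U : Submodule ℚ (Fin 4 → ℚ) // IsIsotropic t U ∧ U ≠ ⊥}

/-- Two subspaces are equivalent if `U · γ = W` for some `γ ∈ Γ`. -/
def orbitSetoid (t : ℕ) (Γ : Subgroup (Matrix.GeneralLinearGroup (Fin 4) ℤ)) :
    Setoid (IsotropicSubspace t) where
  r U W := ∃ γ ∈ Γ, act γ U.val = W.val
  iseqv :=
    { refl := fun U => ⟨1, Γ.one_mem, act_one U.val⟩
      symm := by
        rintro U W ⟨γ, hγ, h⟩
        refine ⟨γ⁻¹, Γ.inv_mem hγ, ?_⟩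
        rw [← h, ← act_mul, mul_inv_cancel, act_one]
      trans := by
        rintro U V W ⟨γ, hγ, h⟩ ⟨δ, hδ, k⟩
        exact ⟨γ * δ, Γ.mul_mem hγ hδ, by rw [act_mul, h, k]⟩ }

/-- The `Γ`-orbits of nontrivial isotropic subspaces: the vertices of the Tits building. -/
abbrev Orbit (t : ℕ) (Γ : Subgroup (Matrix.GeneralLinearGroup (Fin 4) ℤ)) : Type :=
  Quotient (orbitSetoid t Γ)

/-- The `Γ`-orbit of `U`. -/
def orbitOf (t : ℕ) (Γ : Subgroup (Matrix.GeneralLinearGroup (Fin 4) ℤ))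
    (U : IsotropicSubspace t) : Orbit t Γ :=
  Quotient.mk (orbitSetoid t Γ) U

/-- The `Γ`-orbits of isotropic subspaces of dimension `d`. -/
def orbitsOfDim (t : ℕ) (Γ : Subgroup (Matrix.GeneralLinearGroup (Fin 4) ℤ)) (d : ℕ) :
    Set (Orbit t Γ) :=
  {x | ∃ U : IsotropicSubspace t, orbitOf t Γ U = x ∧ Module.finrank ℚ U.val = d}

/-- The set of `Γ`-orbits of isotropic lines (one-dimensional subspaces). -/
def lineOrbits (t : ℕ) (Γ : Subgroup (Matrix.GeneralLinearGroup (Fin 4) ℤ)) :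
    Set (Orbit t Γ) :=
  orbitsOfDim t Γ 1

/-- The set of `Γ`-orbits of isotropic planes (two-dimensional subspaces). -/
def planeOrbits (t : ℕ) (Γ : Subgroup (Matrix.GeneralLinearGroup (Fin 4) ℤ)) :
    Set (Orbit t Γ) :=
  orbitsOfDim t Γ 2

/-- The Tits building of `Γ`: its vertices are the `Γ`-orbits of nontrivial isotropic subspaces;
the (distinct) orbits of `U` and `W` are joined if and only if `U · γ ⊆ W` or `W ⊆ U · γ` for some
`γ ∈ Γ`. -/
def titsBuilding (t : ℕ) (Γ : Subgroup (Matrix.GeneralLinearGroup (Fin 4) ℤ)) :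
    SimpleGraph (Orbit t Γ) where
  Adj x y := x ≠ y ∧ ∃ U W : IsotropicSubspace t, orbitOf t Γ U = x ∧ orbitOf t Γ W = y ∧
    ∃ γ ∈ Γ, act γ U.val ≤ W.val ∨ W.val ≤ act γ U.val
  symm := by
    constructor
    rintro x y ⟨hne, U, W, hU, hW, γ, hγ, h⟩
    have hinv : act γ⁻¹ (act γ U.val) = U.val := by
      rw [← act_mul, mul_inv_cancel, act_one]
    refine ⟨hne.symm, W, U, hW, hU, γ⁻¹, Γ.inv_mem hγ, ?_⟩
    rcases h with h | h
    · exact Or.inr (hinv ▸ act_mono γ⁻¹ h)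
    · exact Or.inl (hinv ▸ act_mono γ⁻¹ h)
  loopless := by
    constructor
    rintro x ⟨h, -⟩
    exact h rfl

/-- The graph `G` is the incidence graph of an `(a_b, c_d)`-configuration with set of points `P`
and set of blocks `B`: there are `a` points, each on exactly `b` blocks, and `c` blocks, each with
exactly `d` points. -/
structure IsConfiguration {V : Type} (G : SimpleGraph V) (P B : Set V) (a b c d : ℕ) : Prop where
  bipartite : G.IsBipartiteWith P B
  union_eq : P ∪ B = Set.univ
  ncard_points : P.ncard = a
  blocks_through : ∀ x ∈ P, (G.neighborSet x).ncard = b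
  ncard_blocks : B.ncard = c
  points_on : ∀ y ∈ B, (G.neighborSet y).ncard = d

end SiegelTits

/-!
The lattice `ℤ⁴` with the form `Λ` is the orthogonal sum of a unimodular hyperbolic plane
(coordinates `0, 2`) and a hyperbolic plane scaled by the prime `p` (coordinates `1, 3`). The values
`⟨v, ℤ⁴⟩` of a primitive vector `v` generate `ℤ` or `pℤ`. In the first case `v` has divisor one
(`HasDivisorOne`); in the second case `v` is the image of a vector of divisor one under the swap
`(a, b, c, d) ↦ (p b, a, p d, c)`, a similitude of `Λ` of multiplier `p`
(`hasDivisorOne_or_eq_swap`).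
Conjugation by the swap preserves the level groups (`exists_levelGroup_mul_swapMatrix`), so the swap
acts on the building, and everything that concerns lines of the second kind is reduced to lines of
the first kind.

The arithmetic core is that two vectors of divisor one are equivalent under the level group as soon
as they are congruent (`exists_levelGroup_vecMul_eq`). This is reduced to `e₀` by normality, and there an
Eichler transvection makes the coordinates `0, 2` coprime, after which `SL(2)` and another
transvection finish. For level one this is transitivity, and it follows that, up to similitudes
normalizing the level group, the isotropic subspaces are `⟨e₀⟩` and `⟨e₀, e₁⟩` only
(`exists_isSimilitude_map_eq`).

Lines of the first kind are thus classified by `v mod q` up to sign, planes through `e₀` by the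
residues of the coprime coordinates of `⟨e₀, y e₁ + z e₃⟩` up to sign (`orbitOf_planeOf_eq_iff`).
The residues that occur form the sets `admissible`, and the three counts of lines, of planes through a
line, and of lines in a plane are counts of residues modulo sign (`ncard_image_eq_mul`). The number
of planes follows by counting the edges of the building in two ways (`ncard_mul_eq_ncard_mul`).
-/

namespace SiegelTits

open Matrix

/-! ### Elements of the level groups -/

theorem mem_levelGroup {t n : ℕ} {γ : GeneralLinearGroup (Fin 4) ℤ} :
    γ ∈ levelGroup t n ↔ γ.val * formMatrix t * γ.valᵀ = formMatrix t ∧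
      γ.val.map (Int.cast : ℤ → ZMod n) = 1 := by
  rw [levelGroup, Subgroup.mem_inf, MonoidHom.mem_ker, Units.ext_iff]
  rfl

theorem det_formMatrix (t : ℕ) : (formMatrix t).det = (t : ℤ) ^ 2 := by
  simp [formMatrix, det_succ_row_zero, Fin.sum_univ_succ, Fin.succAbove]
  ring

/-- An integral matrix preserving the form has determinant `±1`, hence is invertible. -/
theorem exists_mem_levelGroup {t n : ℕ} (ht : t ≠ 0) (A : Matrix (Fin 4) (Fin 4) ℤ)
    (hA : A * formMatrix t * Aᵀ = formMatrix t) (hn : A.map (Int.cast : ℤ → ZMod n) = 1) :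
    ∃ γ ∈ levelGroup t n, γ.val = A := by
  have hd : A.det * A.det = 1 := by
    have h := congrArg Matrix.det hA
    rw [det_mul, det_mul, det_transpose, det_formMatrix] at h
    have ht' : ((t : ℤ) ^ 2) ≠ 0 := by positivity
    exact mul_right_cancel₀ ht' (by linarith)
  obtain ⟨γ, hγ⟩ := (A.isUnit_iff_isUnit_det).2 (IsUnit.of_mul_eq_one _ hd)
  exact ⟨γ, mem_levelGroup.2 ⟨by rw [hγ, hA], by rw [hγ, hn]⟩, hγ⟩

theorem levelGroup_le (t n : ℕ) : levelGroup t n ≤ symplecticGroup t :=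
  inf_le_left

theorem levelGroup_one (t : ℕ) : levelGroup t 1 = symplecticGroup t := by
  ext γ
  rw [mem_levelGroup]
  exact ⟨fun h => h.1, fun h => ⟨h, Subsingleton.elim _ _⟩⟩

theorem conj_mem_levelGroup {t n : ℕ} {g γ : GeneralLinearGroup (Fin 4) ℤ}
    (hg : g ∈ symplecticGroup t) (hγ : γ ∈ levelGroup t n) : g⁻¹ * γ * g ∈ levelGroup t n := by
  rw [levelGroup, Subgroup.mem_inf, MonoidHom.mem_ker] at *
  refine ⟨mul_mem (mul_mem (inv_mem hg) hγ.1) hg, ?_⟩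
  rw [map_mul, map_mul, map_inv, hγ.2, mul_one, inv_mul_cancel]

/-- The action of `SL(2)` on the hyperbolic plane of the coordinates `0, 2`. -/
theorem exists_levelGroup_sl_zero_two {t n : ℕ} (ht : t ≠ 0) {a b c d : ℤ}
    (hdet : a * d - b * c = 1) (ha : (a : ZMod n) = 1) (hb : (b : ZMod n) = 0)
    (hc : (c : ZMod n) = 0) (hd : (d : ZMod n) = 1) :
    ∃ γ ∈ levelGroup t n, ∀ v : Fin 4 → ℤ,
      v ᵥ* γ.val = ![v 0 * a + v 2 * c, v 1, v 0 * b + v 2 * d, v 3] := by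
  obtain ⟨γ, hγ, h⟩ := exists_mem_levelGroup (n := n) ht
    !![a, 0, b, 0; 0, 1, 0, 0; c, 0, d, 0; 0, 0, 0, 1]
    (by
      ext i j
      fin_cases i <;> fin_cases j <;>
        simp [formMatrix, mul_apply, Fin.sum_univ_four] <;> linarith)
    (by ext i j; fin_cases i <;> fin_cases j <;> simp [ha, hb, hc, hd])
  refine ⟨γ, hγ, fun v => ?_⟩
  rw [h]
  ext j
  fin_cases j <;> simp [vecMul, dotProduct, Fin.sum_univ_four]

/-- The action of `SL(2)` on the plane of the coordinates `1, 3`. -/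
theorem exists_levelGroup_sl_one_three {t n : ℕ} (ht : t ≠ 0) {a b c d : ℤ}
    (hdet : a * d - b * c = 1) (ha : (a : ZMod n) = 1) (hb : (b : ZMod n) = 0)
    (hc : (c : ZMod n) = 0) (hd : (d : ZMod n) = 1) :
    ∃ γ ∈ levelGroup t n, ∀ v : Fin 4 → ℤ,
      v ᵥ* γ.val = ![v 0, v 1 * a + v 3 * c, v 2, v 1 * b + v 3 * d] := by
  obtain ⟨γ, hγ, h⟩ := exists_mem_levelGroup (n := n) ht
    !![1, 0, 0, 0; 0, a, 0, b; 0, 0, 1, 0; 0, c, 0, d]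
    (by
      ext i j
      fin_cases i <;> fin_cases j <;>
        simp [formMatrix, mul_apply, Fin.sum_univ_four] <;>
        first
        | ring1
        | linear_combination (t : ℤ) * hdet
        | linear_combination (-t : ℤ) * hdet)
    (by ext i j; fin_cases i <;> fin_cases j <;> simp [ha, hb, hc, hd])
  refine ⟨γ, hγ, fun v => ?_⟩
  rw [h]
  ext j
  fin_cases j <;> simp [vecMul, dotProduct, Fin.sum_univ_four]

/-- The Eichler transvection fixing `e₂` that moves `e₀` to `e₀ + x e₁ + y e₃`. -/
theorem exists_levelGroup_eichler {t n : ℕ} (ht : t ≠ 0) {x y : ℤ}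
    (hx : (x : ZMod n) = 0) (hy : (y : ZMod n) = 0) :
    ∃ γ ∈ levelGroup t n, ∀ v : Fin 4 → ℤ,
      v ᵥ* γ.val = ![v 0, v 1 + v 0 * x, v 2 + t * (y * v 1 - x * v 3), v 3 + v 0 * y] := by
  obtain ⟨γ, hγ, h⟩ := exists_mem_levelGroup (n := n) ht
    !![1, x, 0, y; 0, 1, t * y, 0; 0, 0, 1, 0; 0, 0, -(t * x), 1]
    (by
      ext i j
      fin_cases i <;> fin_cases j <;>
        simp [formMatrix, mul_apply, Fin.sum_univ_four] <;> ring)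
    (by ext i j; fin_cases i <;> fin_cases j <;> simp [hx, hy])
  refine ⟨γ, hγ, fun v => ?_⟩
  rw [h]
  ext j
  fin_cases j <;> simp [vecMul, dotProduct, Fin.sum_univ_four] <;> ring

/-! ### Vectors of divisor one -/

/-- The values `⟨v, x⟩` of the form `Λ` at integral vectors `x` generate the unit ideal. -/
def HasDivisorOne (t : ℕ) (v : Fin 4 → ℤ) : Prop :=
  ∃ x : Fin 4 → ℤ, v ⬝ᵥ (formMatrix t *ᵥ x) = 1

theorem dotProduct_formMatrix (t : ℕ) (v x : Fin 4 → ℤ) :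
    v ⬝ᵥ (formMatrix t *ᵥ x) = v 0 * x 2 - v 2 * x 0 + t * (v 1 * x 3 - v 3 * x 1) := by
  simp [formMatrix, mulVec, dotProduct, Fin.sum_univ_four]
  ring

theorem hasDivisorOne_iff {t : ℕ} {v : Fin 4 → ℤ} :
    HasDivisorOne t v ↔ ∃ a b c d : ℤ, a * v 0 + b * v 2 + t * (c * v 1 + d * v 3) = 1 := by
  constructor
  · rintro ⟨x, hx⟩
    rw [dotProduct_formMatrix] at hx
    exact ⟨x 2, -x 0, x 3, -x 1, by linarith⟩
  · rintro ⟨a, b, c, d, h⟩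
    refine ⟨![-b, -d, a, c], ?_⟩
    rw [dotProduct_formMatrix]
    simp
    linarith

theorem HasDivisorOne.vecMul {t : ℕ} {v : Fin 4 → ℤ} (hv : HasDivisorOne t v)
    {g : GeneralLinearGroup (Fin 4) ℤ} (hg : g ∈ symplecticGroup t) :
    HasDivisorOne t (v ᵥ* g.val) := by
  obtain ⟨x, hx⟩ := hv
  have hg' : g.val * formMatrix t * g.valᵀ = formMatrix t := hg
  refine ⟨g.valᵀ *ᵥ x, ?_⟩
  rw [dotProduct_mulVec, vecMul_vecMul, dotProduct_mulVec, vecMul_vecMul, hg',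
    ← dotProduct_mulVec, hx]

/-- Adding a suitable multiple of `c` makes `b` coprime to `a ≠ 0`: the multiplier has to avoid
a residue class modulo each prime divisor of `a`, and the product of the prime divisors of `a`
that do not divide `b` does so. -/
theorem exists_isCoprime_add_mul {a b c : ℤ} (ha : a ≠ 0)
    (h : ∀ r : ℕ, r.Prime → (r : ℤ) ∣ a → (r : ℤ) ∣ b → (r : ℤ) ∣ c → False) :
    ∃ k : ℤ, IsCoprime a (b + k * c) := by
  classical
  refine ⟨∏ r ∈ a.natAbs.primeFactors.filter (fun r : ℕ => ¬ ((r : ℤ) ∣ b)), (r : ℤ), ?_⟩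
  rw [Int.isCoprime_iff_gcd_eq_one]
  by_contra hg
  obtain ⟨r, hr, hrg⟩ := Nat.exists_prime_and_dvd hg
  have hra : (r : ℤ) ∣ a := (Int.natCast_dvd_natCast.2 hrg).trans (Int.gcd_dvd_left ..)
  have hrb := (Int.natCast_dvd_natCast.2 hrg).trans (Int.gcd_dvd_right ..)
  have hmem : r ∈ a.natAbs.primeFactors :=
    Nat.mem_primeFactors.2 ⟨hr, Int.natCast_dvd.1 hra, by simpa using ha⟩
  by_cases hb : (r : ℤ) ∣ b
  · rcases (Nat.prime_iff_prime_int.1 hr).dvd_or_dvd ((dvd_add_right hb).1 hrb) with h1 | h1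
    · obtain ⟨s, hs, hrs⟩ := ((Nat.prime_iff_prime_int.1 hr).dvd_finsetProd_iff _).1 h1
      rw [Finset.mem_filter] at hs
      have : r = s :=
        (Nat.prime_dvd_prime_iff_eq hr (Nat.prime_of_mem_primeFactors hs.1)).1
          (Int.natCast_dvd_natCast.1 hrs)
      exact hs.2 (this ▸ hb)
    · exact h r hr hra hb h1
  · have h1 : (r : ℤ) ∣ ∏ r ∈ a.natAbs.primeFactors.filter (fun r : ℕ => ¬ ((r : ℤ) ∣ b)), (r : ℤ) :=
      Finset.dvd_prod_of_mem (fun r : ℕ => (r : ℤ)) (Finset.mem_filter.2 ⟨hmem, hb⟩)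
    exact hb ((dvd_add_left (h1.mul_right c)).1 hrb)

/-- A coprime pair `(a, b) ≡ (1, 0)` is the first row of a matrix of `SL(2)` congruent to `1`. -/
theorem exists_sl_completion {n : ℕ} {a b : ℤ} (h : IsCoprime a b) (ha : (a : ZMod n) = 1)
    (hb : (b : ZMod n) = 0) :
    ∃ c d : ℤ, a * d - b * c = 1 ∧ (c : ZMod n) = 0 ∧ (d : ZMod n) = 1 := by
  obtain ⟨x, y, h⟩ := h
  have hx : (x : ZMod n) = 1 := by
    have := congrArg (Int.cast : ℤ → ZMod n) h
    simpa [ha, hb] using this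
  -- `(-y, x)` is a second row; subtracting `-y` times the first makes it congruent to `(0, 1)`.
  refine ⟨-y + y * a, x + y * b, by linear_combination h, by simp [ha], by simp [hx, hb]⟩

/-- The orbit of `e₀` under the level group consists of all vectors of divisor one congruent
to `e₀`. -/
theorem exists_levelGroup_vecMul_single_zero {t n : ℕ} (ht : 2 ≤ t) {v : Fin 4 → ℤ}
    (hv : HasDivisorOne t v) (h0 : (v 0 : ZMod n) = 1) (h1 : (v 1 : ZMod n) = 0)
    (h2 : (v 2 : ZMod n) = 0) (h3 : (v 3 : ZMod n) = 0) :
    ∃ γ ∈ levelGroup t n, ![1, 0, 0, 0] ᵥ* γ.val = v := by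
  have ht0 : t ≠ 0 := by omega
  -- reduction step: it is enough to treat a translate of `v`
  have step : ∀ w : Fin 4 → ℤ, (∃ γ ∈ levelGroup t n, v ᵥ* γ.val = w) →
      (∃ γ ∈ levelGroup t n, ![1, 0, 0, 0] ᵥ* γ.val = w) →
      ∃ γ ∈ levelGroup t n, ![1, 0, 0, 0] ᵥ* γ.val = v := by
    rintro w ⟨γ, hγ, hw⟩ ⟨δ, hδ, hw'⟩
    refine ⟨δ * γ⁻¹, mul_mem hδ (inv_mem hγ), ?_⟩
    rw [Units.val_mul, ← vecMul_vecMul, hw', ← hw, vecMul_vecMul, ← Units.val_mul]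
    simp
  -- coprime first and third coordinates
  have main : ∀ w : Fin 4 → ℤ, IsCoprime (w 0) (w 2) → (w 0 : ZMod n) = 1 →
      (w 1 : ZMod n) = 0 → (w 2 : ZMod n) = 0 → (w 3 : ZMod n) = 0 →
      ∃ γ ∈ levelGroup t n, ![1, 0, 0, 0] ᵥ* γ.val = w := by
    intro w hc w0 w1 w2 w3
    obtain ⟨c, d, hdet, hc0, hd1⟩ := exists_sl_completion hc w0 w2
    obtain ⟨γ, hγ, hγv⟩ := exists_levelGroup_sl_zero_two (t := t) ht0 hdet w0 w2 hc0 hd1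
    obtain ⟨δ, hδ, hδv⟩ := exists_levelGroup_eichler (t := t) ht0 w1 w3
    refine ⟨δ * γ, mul_mem hδ hγ, ?_⟩
    rw [Units.val_mul, ← vecMul_vecMul, hδv, hγv]
    ext j
    fin_cases j <;> simp
  -- nonzero first coordinate
  have main' : ∀ w : Fin 4 → ℤ, HasDivisorOne t w → w 0 ≠ 0 → (w 0 : ZMod n) = 1 →
      (w 1 : ZMod n) = 0 → (w 2 : ZMod n) = 0 → (w 3 : ZMod n) = 0 →
      ∃ w' : Fin 4 → ℤ, (∃ γ ∈ levelGroup t n, w ᵥ* γ.val = w') ∧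
        ∃ γ ∈ levelGroup t n, ![1, 0, 0, 0] ᵥ* γ.val = w' := by
    intro w hw hne w0 w1 w2 w3
    obtain ⟨k, hk⟩ := exists_isCoprime_add_mul (a := w 0) (b := w 2)
      (c := n * (t * (Int.gcd (w 1) (w 3) : ℤ))) hne (by
        intro r hr hr0 hr2 hrc
        have hrp := Nat.prime_iff_prime_int.1 hr
        rcases hrp.dvd_or_dvd hrc with hrn | hrt
        · have : (w 0 : ZMod r) = 1 := by
            have := congrArg (ZMod.castHom (Int.natCast_dvd_natCast.1 hrn) (ZMod r)) w0
            simpa only [map_intCast, map_one] using this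
          rw [(ZMod.intCast_zmod_eq_zero_iff_dvd _ _).2 hr0] at this
          have : Fact (1 < r) := ⟨hr.one_lt⟩
          exact zero_ne_one ‹(0 : ZMod r) = 1›
        · obtain ⟨a, b, c, d, h⟩ := hasDivisorOne_iff.1 hw
          have h1 : (t * (Int.gcd (w 1) (w 3) : ℤ)) ∣ t * (c * w 1 + d * w 3) :=
            mul_dvd_mul_left _ (dvd_add ((Int.gcd_dvd_left ..).mul_left _)
              ((Int.gcd_dvd_right ..).mul_left _))
          exact hrp.not_dvd_one (h ▸ dvd_add (dvd_add (hr0.mul_left _) (hr2.mul_left _))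
            (hrt.trans h1)))
    set x : ℤ := -(n * k * Int.gcdB (w 1) (w 3)) with hx
    set y : ℤ := n * k * Int.gcdA (w 1) (w 3) with hy
    obtain ⟨δ, hδ, hδv⟩ := exists_levelGroup_eichler (t := t) (n := n) ht0 (x := x) (y := y)
      (by simp [hx]) (by simp [hy])
    refine ⟨_, ⟨δ, hδ, hδv w⟩, main _ ?_ ?_ ?_ ?_ ?_⟩
    · have h2 : w 2 + t * (y * w 1 - x * w 3) =
          w 2 + k * (n * (t * (Int.gcd (w 1) (w 3) : ℤ))) := by
        rw [Int.gcd_eq_gcd_ab, hx, hy]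
        ring
      change IsCoprime (w 0) (w 2 + t * (y * w 1 - x * w 3))
      rwa [h2]
    all_goals simp [hx, hy, w0, w1, w2, w3]
  by_cases hne : v 0 = 0
  · -- only possible for `n = 1`
    obtain ⟨γ, hγ, hγv⟩ := exists_levelGroup_sl_zero_two (t := t) (n := n) ht0
      (a := 1) (b := 0) (c := n) (d := 1) (by ring) (by simp) (by simp) (by simp) (by simp)
    have hw := hv.vecMul hγ.1
    obtain ⟨w', ⟨δ, hδ, hδw⟩, h'⟩ := main' (v ᵥ* γ.val) hw
      (by
        rw [hγv]
        simp only [hne, zero_mul, zero_add, cons_val_zero]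
        have h2 : v 2 ≠ 0 := by
          intro h2
          obtain ⟨a, b, c, d, h⟩ := hasDivisorOne_iff.1 hv
          rw [hne, h2] at h
          have : (t : ℤ) ∣ 1 := ⟨c * v 1 + d * v 3, by linarith⟩
          have := Int.le_of_dvd one_pos this
          omega
        have hn : n ≠ 0 := by
          rintro rfl
          simp [hne] at h0
        exact mul_ne_zero h2 (by exact_mod_cast hn))
      (by simp [hγv, h0]) (by simp [hγv, h1]) (by simp [hγv, h2]) (by simp [hγv, h3])
    refine step w' ⟨γ * δ, mul_mem hγ hδ, ?_⟩ h'
    rw [Units.val_mul, ← vecMul_vecMul, hδw]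
  · obtain ⟨w', h, h'⟩ := main' v hv hne h0 h1 h2 h3
    exact step w' h h'

theorem exists_symplectic_vecMul_single_zero {t : ℕ} (ht : 2 ≤ t) {v : Fin 4 → ℤ}
    (hv : HasDivisorOne t v) : ∃ g ∈ symplecticGroup t, ![1, 0, 0, 0] ᵥ* g.val = v := by
  rw [← levelGroup_one]
  exact exists_levelGroup_vecMul_single_zero ht hv (Subsingleton.elim _ _)
    (Subsingleton.elim _ _) (Subsingleton.elim _ _) (Subsingleton.elim _ _)

theorem cast_vecMul_of_mem {t n : ℕ} {γ : GeneralLinearGroup (Fin 4) ℤ}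
    (hγ : γ ∈ levelGroup t n) (v : Fin 4 → ℤ) (i : Fin 4) :
    (((v ᵥ* γ.val) i : ℤ) : ZMod n) = (v i : ZMod n) := by
  have h := (mem_levelGroup.1 hγ).2
  have h1 : (((v ᵥ* γ.val) i : ℤ) : ZMod n) =
      ((fun j => (v j : ZMod n)) ᵥ* γ.val.map (Int.cast : ℤ → ZMod n)) i := by
    simp [vecMul, dotProduct]
  rw [h1, h, vecMul_one]

/-- Vectors of divisor one are classified by their reduction modulo `n`. -/
theorem exists_levelGroup_vecMul_eq {t n : ℕ} (ht : 2 ≤ t) {v w : Fin 4 → ℤ}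
    (hv : HasDivisorOne t v) (hw : HasDivisorOne t w)
    (h : ∀ i, (v i : ZMod n) = (w i : ZMod n)) :
    ∃ γ ∈ levelGroup t n, v ᵥ* γ.val = w := by
  obtain ⟨g, hg, rfl⟩ := exists_symplectic_vecMul_single_zero ht hv
  have hw' := hw.vecMul (inv_mem hg)
  have hcong : ∀ i, (((w ᵥ* (g⁻¹).val) i : ℤ) : ZMod n) = ((![1, 0, 0, 0] i : ℤ) : ZMod n) := by
    intro i
    have h1 : (![1, 0, 0, 0] : Fin 4 → ℤ) = (![1, 0, 0, 0] ᵥ* g.val) ᵥ* (g⁻¹).val := by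
      rw [vecMul_vecMul, ← Units.val_mul]; simp
    rw [h1]
    simp only [vecMul, dotProduct] at h ⊢
    push_cast at h ⊢
    simp only [h]
  obtain ⟨γ, hγ, hγw⟩ := exists_levelGroup_vecMul_single_zero (n := n) ht hw'
    (by simpa using hcong 0) (by simpa using hcong 1) (by simpa using hcong 2)
    (by simpa using hcong 3)
  refine ⟨g⁻¹ * γ * g, conj_mem_levelGroup hg hγ, ?_⟩
  rw [vecMul_vecMul, ← Units.val_mul, mul_assoc g⁻¹, mul_inv_cancel_left, Units.val_mul,
    ← vecMul_vecMul, hγw, vecMul_vecMul, ← Units.val_mul]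
  simp

/-- Congruent coprime pairs are equivalent under the principal congruence subgroup of `SL(2)`. -/
theorem exists_sl_of_congruent {n : ℕ} {x y x' y' : ℤ} (h : IsCoprime x y) (h' : IsCoprime x' y')
    (hx : (x : ZMod n) = x') (hy : (y : ZMod n) = y') :
    ∃ a b c d : ℤ, a * d - b * c = 1 ∧ (a : ZMod n) = 1 ∧ (b : ZMod n) = 0 ∧ (c : ZMod n) = 0 ∧
      (d : ZMod n) = 1 ∧ x * a + y * c = x' ∧ x * b + y * d = y' := by
  obtain ⟨r, s, hrs⟩ := h
  -- `B = (x y; -s r)` has `(1, 0) B = (x, y)`; the pair `(z, w) = (x', y') B⁻¹` is `≡ (1, 0)`.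
  set z := x' * r + y' * s with hz
  set w := -(x' * y) + y' * x with hw
  have hrs' : (r : ZMod n) * x + s * y = 1 := by exact_mod_cast congrArg (Int.cast : ℤ → ZMod n) hrs
  have hz1 : (z : ZMod n) = 1 := by
    simp only [hz, Int.cast_add, Int.cast_mul, ← hx, ← hy]
    linear_combination hrs'
  have hw0 : (w : ZMod n) = 0 := by
    simp only [hw, Int.cast_add, Int.cast_mul, Int.cast_neg, ← hx, ← hy]
    ring
  have hzw : IsCoprime z w := by
    obtain ⟨e, f, hef⟩ := h'
    refine ⟨e * x + f * y, -(e * s) + f * r, ?_⟩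
    rw [hz, hw]
    linear_combination (e * x' + f * y') * hrs + hef
  obtain ⟨c, d, hdet, hc, hd⟩ := exists_sl_completion hzw hz1 hw0
  -- the matrix `B⁻¹ (z w; c d) B`
  refine ⟨(r * z - y * c) * x - (r * w - y * d) * s, (r * z - y * c) * y + (r * w - y * d) * r,
    (s * z + x * c) * x - (s * w + x * d) * s, (s * z + x * c) * y + (s * w + x * d) * r,
    ?_, ?_, ?_, ?_, ?_, ?_, ?_⟩
  · linear_combination (r * x + s * y) ^ 2 * hdet + (r * x + s * y + 1) * hrs
  · push_cast; rw [hz1, hw0, hc, hd]; linear_combination hrs'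
  · push_cast; rw [hz1, hw0, hc, hd]; ring
  · push_cast; rw [hz1, hw0, hc, hd]; ring
  · push_cast; rw [hz1, hw0, hc, hd]; linear_combination hrs'
  · rw [hz, hw]
    linear_combination (x' * (r * x + s * y) + x') * hrs
  · rw [hz, hw]
    linear_combination (y' * (r * x + s * y) + y') * hrs

/-! ### The action on rational subspaces -/

/-- An integral vector as a rational one. -/
def intVec {ι : Type*} (v : ι → ℤ) : ι → ℚ := fun i => (v i : ℚ)

theorem intVec_injective {ι : Type*} : Function.Injective (intVec (ι := ι)) :=
  fun _ _ h => funext fun i => Int.cast_injective (congrFun h i)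

theorem intVec_vecMul (v : Fin 4 → ℤ) (A : Matrix (Fin 4) (Fin 4) ℤ) :
    intVec v ᵥ* A.map (Int.cast : ℤ → ℚ) = intVec (v ᵥ* A) := by
  ext i
  simp [intVec, vecMul, dotProduct]

theorem mem_act_of_mem {γ : GeneralLinearGroup (Fin 4) ℤ} {U : Submodule ℚ (Fin 4 → ℚ)}
    {v : Fin 4 → ℤ} (h : intVec v ∈ U) : intVec (v ᵥ* γ.val) ∈ act γ U :=
  ⟨intVec v, h, by rw [vecMulLinear_apply, intVec_vecMul]⟩

theorem act_span_singleton (γ : GeneralLinearGroup (Fin 4) ℤ) (v : Fin 4 → ℤ) :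
    act γ (ℚ ∙ intVec v) = ℚ ∙ intVec (v ᵥ* γ.val) := by
  rw [act, Submodule.map_span, Set.image_singleton, vecMulLinear_apply, intVec_vecMul]

theorem act_span_pair (γ : GeneralLinearGroup (Fin 4) ℤ) (v w : Fin 4 → ℤ) :
    act γ (Submodule.span ℚ {intVec v, intVec w}) =
      Submodule.span ℚ {intVec (v ᵥ* γ.val), intVec (w ᵥ* γ.val)} := by
  rw [act, Submodule.map_span, Set.image_pair, vecMulLinear_apply, vecMulLinear_apply,
    intVec_vecMul, intVec_vecMul]

theorem map_cast_mul (A B : Matrix (Fin 4) (Fin 4) ℤ) :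
    (A * B).map (Int.cast : ℤ → ℚ) = A.map Int.cast * B.map Int.cast :=
  Matrix.map_mul (f := Int.castRingHom ℚ)

theorem vecMul_inv_cancel_rat (g : GeneralLinearGroup (Fin 4) ℤ) (v : Fin 4 → ℚ) :
    (v ᵥ* g.val.map (Int.cast : ℤ → ℚ)) ᵥ* (g⁻¹).val.map (Int.cast : ℤ → ℚ) = v := by
  have h : g.val.map (Int.cast : ℤ → ℚ) * (g⁻¹).val.map (Int.cast : ℤ → ℚ) = 1 := by
    rw [← map_cast_mul, ← Units.val_mul, mul_inv_cancel, Units.val_one]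
    exact Matrix.map_one _ Int.cast_zero Int.cast_one
  rw [vecMul_vecMul, h, vecMul_one]

/-- The linear automorphism `v ↦ v g` of `ℚ⁴`. -/
def rowEquiv (g : GeneralLinearGroup (Fin 4) ℤ) : (Fin 4 → ℚ) ≃ₗ[ℚ] (Fin 4 → ℚ) :=
  LinearEquiv.ofLinearMap (vecMulLinear (g.val.map Int.cast)) (vecMulLinear ((g⁻¹).val.map Int.cast))
    (LinearMap.ext fun v => by simpa using vecMul_inv_cancel_rat g⁻¹ v)
    (LinearMap.ext fun v => vecMul_inv_cancel_rat g v)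

theorem rowEquiv_apply (g : GeneralLinearGroup (Fin 4) ℤ) (v : Fin 4 → ℚ) :
    rowEquiv g v = v ᵥ* g.val.map (Int.cast : ℤ → ℚ) := rfl

theorem rowEquiv_mul (a b : GeneralLinearGroup (Fin 4) ℤ) (v : Fin 4 → ℚ) :
    rowEquiv (a * b) v = rowEquiv b (rowEquiv a v) := by
  simp only [rowEquiv_apply, Units.val_mul, vecMul_vecMul, map_cast_mul]

theorem map_rowEquiv (g : GeneralLinearGroup (Fin 4) ℤ) (U : Submodule ℚ (Fin 4 → ℚ)) :
    U.map (rowEquiv g : (Fin 4 → ℚ) →ₗ[ℚ] (Fin 4 → ℚ)) = act g U := rfl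

theorem finrank_act (γ : GeneralLinearGroup (Fin 4) ℤ) (U : Submodule ℚ (Fin 4 → ℚ)) :
    Module.finrank ℚ (act γ U) = Module.finrank ℚ U := by
  rw [← map_rowEquiv]
  exact LinearEquiv.finrank_map_eq (rowEquiv γ) U

theorem act_inv_act (γ : GeneralLinearGroup (Fin 4) ℤ) (U : Submodule ℚ (Fin 4 → ℚ)) :
    act γ⁻¹ (act γ U) = U := by
  rw [← act_mul, mul_inv_cancel, act_one]

/-- The alternating form `Λ` on `ℚ⁴`. -/
def ratForm (t : ℕ) (v w : Fin 4 → ℚ) : ℚ :=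
  v ⬝ᵥ ((formMatrix t).map (Int.cast : ℤ → ℚ)).mulVec w

theorem ratForm_eq (t : ℕ) (v w : Fin 4 → ℚ) :
    ratForm t v w = v 0 * w 2 - v 2 * w 0 + t * (v 1 * w 3 - v 3 * w 1) := by
  simp [ratForm, formMatrix, mulVec, dotProduct, Fin.sum_univ_four]
  ring

theorem ratForm_vecMul {t : ℕ} {g : GeneralLinearGroup (Fin 4) ℤ} (hg : g ∈ symplecticGroup t)
    (v w : Fin 4 → ℚ) :
    ratForm t (v ᵥ* g.val.map (Int.cast : ℤ → ℚ)) (w ᵥ* g.val.map (Int.cast : ℤ → ℚ)) =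
      ratForm t v w := by
  have hg' : g.val * formMatrix t * g.valᵀ = formMatrix t := hg
  have h := congrArg (fun A : Matrix (Fin 4) (Fin 4) ℤ => A.map (Int.castRingHom ℚ)) hg'
  simp only [Matrix.map_mul, transpose_map] at h
  have h' : g.val.map (Int.cast : ℤ → ℚ) * (formMatrix t).map (Int.cast : ℤ → ℚ) *
    (g.val.map (Int.cast : ℤ → ℚ))ᵀ = (formMatrix t).map (Int.cast : ℤ → ℚ) := h
  rw [ratForm, ratForm, ← mulVec_transpose _ w, dotProduct_mulVec, dotProduct_mulVec,
    vecMul_vecMul, vecMul_vecMul, ← Matrix.mul_assoc, h', ← dotProduct_mulVec]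

/-! ### Symmetries of the building -/

section Orbits

variable {t : ℕ} {Γ : Subgroup (GeneralLinearGroup (Fin 4) ℤ)}

theorem orbitOf_eq_iff {U W : IsotropicSubspace t} :
    orbitOf t Γ U = orbitOf t Γ W ↔ ∃ γ ∈ Γ, act γ U.val = W.val :=
  Quotient.eq

theorem finrank_eq_of_orbitOf_eq {U W : IsotropicSubspace t}
    (h : orbitOf t Γ U = orbitOf t Γ W) : Module.finrank ℚ U.val = Module.finrank ℚ W.val := by
  obtain ⟨γ, -, h⟩ := orbitOf_eq_iff.1 h
  rw [← h, finrank_act]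

end Orbits

/-- A similitude of the form `Λ` on `ℚ⁴` that normalizes `Γ`: conjugation by it maps `Γ` into
(`conj`) and onto (`conj_symm`) itself. -/
structure IsSimilitude (t : ℕ) (Γ : Subgroup (GeneralLinearGroup (Fin 4) ℤ))
    (e : (Fin 4 → ℚ) ≃ₗ[ℚ] (Fin 4 → ℚ)) : Prop where
  form : ∃ c : ℚ, c ≠ 0 ∧ ∀ v w, ratForm t (e v) (e w) = c * ratForm t v w
  conj : ∀ γ ∈ Γ, ∃ γ' ∈ Γ, ∀ v, e (rowEquiv γ v) = rowEquiv γ' (e v)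
  conj_symm : ∀ γ' ∈ Γ, ∃ γ ∈ Γ, ∀ v, e (rowEquiv γ v) = rowEquiv γ' (e v)

namespace IsSimilitude

variable {t : ℕ} {Γ : Subgroup (GeneralLinearGroup (Fin 4) ℤ)}
  {e e' : (Fin 4 → ℚ) ≃ₗ[ℚ] (Fin 4 → ℚ)}

theorem trans (h : IsSimilitude t Γ e) (h' : IsSimilitude t Γ e') :
    IsSimilitude t Γ (e.trans e') where
  form := by
    obtain ⟨c, hc, hf⟩ := h.form
    obtain ⟨c', hc', hf'⟩ := h'.form
    exact ⟨c' * c, mul_ne_zero hc' hc, fun v w => by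
      rw [LinearEquiv.trans_apply, LinearEquiv.trans_apply, hf', hf, mul_assoc]⟩
  conj γ hγ := by
    obtain ⟨γ', hγ', h1⟩ := h.conj γ hγ
    obtain ⟨γ'', hγ'', h2⟩ := h'.conj γ' hγ'
    exact ⟨γ'', hγ'', fun v => by
      rw [LinearEquiv.trans_apply, LinearEquiv.trans_apply, h1, h2]⟩
  conj_symm γ hγ := by
    obtain ⟨γ', hγ', h1⟩ := h'.conj_symm γ hγ
    obtain ⟨γ'', hγ'', h2⟩ := h.conj_symm γ' hγ'
    exact ⟨γ'', hγ'', fun v => by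
      rw [LinearEquiv.trans_apply, LinearEquiv.trans_apply, h2, h1]⟩

theorem isIsotropic_map_iff (h : IsSimilitude t Γ e) (U : Submodule ℚ (Fin 4 → ℚ)) :
    IsIsotropic t (U.map (e : (Fin 4 → ℚ) →ₗ[ℚ] (Fin 4 → ℚ))) ↔ IsIsotropic t U := by
  obtain ⟨c, hc, hf⟩ := h.form
  constructor
  · intro hU v hv w hw
    have := hU (e v) ⟨v, hv, rfl⟩ (e w) ⟨w, hw, rfl⟩
    change ratForm t (e v) (e w) = 0 at this
    rw [hf] at this
    exact (mul_eq_zero.1 this).resolve_left hc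
  · rintro hU _ ⟨v, hv, rfl⟩ _ ⟨w, hw, rfl⟩
    change ratForm t (e v) (e w) = 0
    rw [hf, show ratForm t v w = 0 from hU v hv w hw, mul_zero]

theorem map_act {γ γ' : GeneralLinearGroup (Fin 4) ℤ}
    (h : ∀ v, e (rowEquiv γ v) = rowEquiv γ' (e v)) (U : Submodule ℚ (Fin 4 → ℚ)) :
    (act γ U).map (e : (Fin 4 → ℚ) →ₗ[ℚ] (Fin 4 → ℚ)) =
      act γ' (U.map (e : (Fin 4 → ℚ) →ₗ[ℚ] (Fin 4 → ℚ))) := by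
  rw [← map_rowEquiv, ← map_rowEquiv, ← Submodule.map_comp, ← Submodule.map_comp]
  congr 1
  exact LinearMap.ext h

/-- The permutation of the isotropic subspaces induced by a similitude. -/
def subspaceEquiv (h : IsSimilitude t Γ e) : IsotropicSubspace t ≃ IsotropicSubspace t :=
  (Submodule.orderIsoMapComap e).toEquiv.subtypeEquiv fun U => by
    change _ ↔ IsIsotropic t (U.map (e : (Fin 4 → ℚ) →ₗ[ℚ] (Fin 4 → ℚ))) ∧
      U.map (e : (Fin 4 → ℚ) →ₗ[ℚ] (Fin 4 → ℚ)) ≠ ⊥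
    rw [h.isIsotropic_map_iff]
    exact and_congr_right fun _ => not_congr
      (Submodule.map_eq_bot_iff (e := e) (p := U)).symm

theorem coe_subspaceEquiv (h : IsSimilitude t Γ e) (U : IsotropicSubspace t) :
    (h.subspaceEquiv U).val = U.val.map (e : (Fin 4 → ℚ) →ₗ[ℚ] (Fin 4 → ℚ)) := rfl

theorem subspaceEquiv_le_iff (h : IsSimilitude t Γ e) {U W : IsotropicSubspace t} :
    (h.subspaceEquiv U).val ≤ (h.subspaceEquiv W).val ↔ U.val ≤ W.val :=
  (Submodule.orderIsoMapComap e).le_iff_le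

theorem finrank_subspaceEquiv (h : IsSimilitude t Γ e) (U : IsotropicSubspace t) :
    Module.finrank ℚ (h.subspaceEquiv U).val = Module.finrank ℚ U.val :=
  LinearEquiv.finrank_map_eq e U.val

/-- The permutation of the vertices of the building induced by a similitude. -/
def orbitEquiv (h : IsSimilitude t Γ e) : Orbit t Γ ≃ Orbit t Γ :=
  Quotient.congr h.subspaceEquiv fun U W => by
    constructor
    · rintro ⟨γ, hγ, hU⟩
      obtain ⟨γ', hγ', hc⟩ := h.conj γ hγ
      refine ⟨γ', hγ', ?_⟩
      rw [coe_subspaceEquiv, coe_subspaceEquiv, ← map_act hc, hU]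
    · rintro ⟨γ', hγ', hU⟩
      obtain ⟨γ, hγ, hc⟩ := h.conj_symm γ' hγ'
      refine ⟨γ, hγ, ?_⟩
      rw [coe_subspaceEquiv, coe_subspaceEquiv, ← map_act hc] at hU
      exact Submodule.map_injective_of_injective e.injective hU

theorem orbitEquiv_orbitOf (h : IsSimilitude t Γ e) (U : IsotropicSubspace t) :
    h.orbitEquiv (orbitOf t Γ U) = orbitOf t Γ (h.subspaceEquiv U) := rfl

end IsSimilitude

section Adjacency

variable {t : ℕ} {Γ : Subgroup (GeneralLinearGroup (Fin 4) ℤ)}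

theorem isSimilitude_rowEquiv {n : ℕ} {g : GeneralLinearGroup (Fin 4) ℤ}
    (hg : g ∈ symplecticGroup t) : IsSimilitude t (levelGroup t n) (rowEquiv g) where
  form := ⟨1, one_ne_zero, fun v w => by
    rw [one_mul]; exact ratForm_vecMul hg v w⟩
  conj γ hγ := ⟨g⁻¹ * γ * g, conj_mem_levelGroup hg hγ, fun v => by
    rw [← rowEquiv_mul, ← rowEquiv_mul, mul_assoc g⁻¹, mul_inv_cancel_left]⟩
  conj_symm γ hγ := ⟨g⁻¹⁻¹ * γ * g⁻¹, conj_mem_levelGroup (inv_mem hg) hγ, fun v => by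
    rw [← rowEquiv_mul, ← rowEquiv_mul, inv_inv, inv_mul_cancel_right]⟩

/-- A symplectic translate of an isotropic subspace. -/
def actIsotropic {g : GeneralLinearGroup (Fin 4) ℤ} (hg : g ∈ symplecticGroup t)
    (U : IsotropicSubspace t) : IsotropicSubspace t :=
  (isSimilitude_rowEquiv (n := 1) hg).subspaceEquiv U

theorem coe_actIsotropic {g : GeneralLinearGroup (Fin 4) ℤ} (hg : g ∈ symplecticGroup t)
    (U : IsotropicSubspace t) : (actIsotropic hg U).val = act g U.val := rfl

/-- When `Γ` preserves the form, the neighbours of the orbit of `U` are represented by subspaces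
comparable with `U` itself. -/
theorem titsBuilding_adj_orbitOf_iff (hΓ : Γ ≤ symplecticGroup t) {U : IsotropicSubspace t}
    {y : Orbit t Γ} : (titsBuilding t Γ).Adj (orbitOf t Γ U) y ↔ orbitOf t Γ U ≠ y ∧
      ∃ W : IsotropicSubspace t, orbitOf t Γ W = y ∧ (U.val ≤ W.val ∨ W.val ≤ U.val) := by
  constructor
  · rintro ⟨hne, V, W, hV, rfl, γ, hγ, h⟩
    refine ⟨hne, ?_⟩
    obtain ⟨δ, hδ, hUV⟩ := orbitOf_eq_iff.1 hV
    have hW := hΓ (mul_mem (inv_mem hγ) hδ)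
    refine ⟨actIsotropic hW W,
      (orbitOf_eq_iff.2 ⟨γ⁻¹ * δ, mul_mem (inv_mem hγ) hδ, rfl⟩).symm, ?_⟩
    rw [coe_actIsotropic, ← hUV, act_mul]
    have hinv := act_inv_act γ V.val
    rcases h with h | h
    · exact Or.inl (act_mono _ (hinv ▸ act_mono γ⁻¹ h))
    · exact Or.inr (act_mono _ (hinv ▸ act_mono γ⁻¹ h))
  · rintro ⟨hne, W, hW, h⟩
    exact ⟨hne, U, W, rfl, hW, 1, Γ.one_mem, by rwa [act_one]⟩

/-- The automorphism of the building induced by a similitude. -/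
def IsSimilitude.buildingIso {e : (Fin 4 → ℚ) ≃ₗ[ℚ] (Fin 4 → ℚ)} (h : IsSimilitude t Γ e)
    (hΓ : Γ ≤ symplecticGroup t) : titsBuilding t Γ ≃g titsBuilding t Γ where
  toEquiv := h.orbitEquiv
  map_rel_iff' := by
    intro x y
    induction x using Quotient.inductionOn with | h U => ?_
    induction y using Quotient.inductionOn with | h V => ?_
    change (titsBuilding t Γ).Adj (h.orbitEquiv (orbitOf t Γ U)) (h.orbitEquiv (orbitOf t Γ V)) ↔
      (titsBuilding t Γ).Adj (orbitOf t Γ U) (orbitOf t Γ V)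
    rw [titsBuilding_adj_orbitOf_iff hΓ, h.orbitEquiv_orbitOf, titsBuilding_adj_orbitOf_iff hΓ,
      ← h.orbitEquiv_orbitOf, h.orbitEquiv.injective.ne_iff]
    refine and_congr_right fun _ => (h.subspaceEquiv.exists_congr fun W => ?_).symm
    rw [← h.orbitEquiv_orbitOf, h.orbitEquiv.injective.eq_iff,
      h.subspaceEquiv_le_iff, h.subspaceEquiv_le_iff]

theorem IsSimilitude.ncard_neighborSet {e : (Fin 4 → ℚ) ≃ₗ[ℚ] (Fin 4 → ℚ)}
    (h : IsSimilitude t Γ e) (hΓ : Γ ≤ symplecticGroup t) (x : Orbit t Γ) :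
    ((titsBuilding t Γ).neighborSet (h.orbitEquiv x)).ncard =
      ((titsBuilding t Γ).neighborSet x).ncard :=
  (Nat.card_congr ((h.buildingIso hΓ).mapNeighborSet x)).symm

end Adjacency

/-! ### The similitude exchanging the two kinds of vectors -/

/-- The matrix of `(a, b, c, d) ↦ (t b, a, t d, c)`, a similitude of `Λ` of multiplier `t`. -/
def swapMatrix (t : ℕ) : Matrix (Fin 4) (Fin 4) ℤ :=
  !![0, 1, 0, 0; (t : ℤ), 0, 0, 0; 0, 0, 0, 1; 0, 0, (t : ℤ), 0]

theorem vecMul_swapMatrix (t : ℕ) (v : Fin 4 → ℤ) :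
    v ᵥ* swapMatrix t = ![t * v 1, v 0, t * v 3, v 2] := by
  ext j
  fin_cases j <;> simp [swapMatrix, vecMul, dotProduct, Fin.sum_univ_four, mul_comm]

theorem swapMatrix_mul_self (t : ℕ) : swapMatrix t * swapMatrix t = (t : ℤ) • 1 := by
  ext i j
  fin_cases i <;> fin_cases j <;> simp [swapMatrix, mul_apply, Fin.sum_univ_four]

theorem swapMatrix_form (t : ℕ) :
    swapMatrix t * formMatrix t * (swapMatrix t)ᵀ = (t : ℤ) • formMatrix t := by
  ext i j
  fin_cases i <;> fin_cases j <;>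
    simp [swapMatrix, formMatrix, mul_apply, Fin.sum_univ_four]

/-- The signed permutation matrix `t⁻¹ · swapMatrix t · Λ`. -/
def swapSign : Matrix (Fin 4) (Fin 4) ℤ :=
  !![0, 0, 0, 1; 0, 0, 1, 0; 0, -1, 0, 0; -1, 0, 0, 0]

theorem swapSign_mul_transpose : swapSign * swapSignᵀ = 1 := by
  ext i j
  fin_cases i <;> fin_cases j <;> simp [swapSign, mul_apply, Fin.sum_univ_four]

theorem swapMatrix_mul_formMatrix (t : ℕ) :
    swapMatrix t * formMatrix t = (t : ℤ) • swapSign := by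
  ext i j
  fin_cases i <;> fin_cases j <;>
    simp [swapMatrix, swapSign, formMatrix, mul_apply, Fin.sum_univ_four]

theorem smul_matrix_cancel {t : ℕ} (ht : t ≠ 0) {A B : Matrix (Fin 4) (Fin 4) ℤ}
    (h : (t : ℤ) • A = (t : ℤ) • B) : A = B := by
  ext i j
  have := congrFun (congrFun h i) j
  simp only [Matrix.smul_apply, smul_eq_mul] at this
  exact mul_left_cancel₀ (by exact_mod_cast ht) this

/-- Conjugation by the swap preserves the level groups: since `γ Λ = Λ γ⁻ᵀ`, conjugating `γ` by
the swap is the same as conjugating `γ⁻ᵀ` by the unimodular matrix `swapSign`. -/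
theorem exists_levelGroup_mul_swapMatrix {t n : ℕ} (ht : t ≠ 0)
    {γ : GeneralLinearGroup (Fin 4) ℤ} (hγ : γ ∈ levelGroup t n) :
    ∃ γ' ∈ levelGroup t n, γ'.val * swapMatrix t = swapMatrix t * γ.val ∧
      γ.val * swapMatrix t = swapMatrix t * γ'.val := by
  obtain ⟨hform, -⟩ := mem_levelGroup.1 hγ
  have hinv := (mem_levelGroup.1 (inv_mem hγ)).2
  set A : Matrix (Fin 4) (Fin 4) ℤ := swapSign * (γ⁻¹).valᵀ * swapSignᵀ with hA
  have hγi : γ.valᵀ * (γ⁻¹).valᵀ = 1 := by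
    rw [← transpose_mul, ← Units.val_mul]; simp
  have hcomm : γ.val * formMatrix t = formMatrix t * (γ⁻¹).valᵀ := by
    conv_rhs => rw [← hform]
    rw [Matrix.mul_assoc, hγi, Matrix.mul_one]
  have hΛ : formMatrix t * (swapSignᵀ * swapMatrix t) = (t : ℤ) • 1 := by
    ext i j
    fin_cases i <;> fin_cases j <;>
      simp [swapMatrix, swapSign, formMatrix, mul_apply, Fin.sum_univ_four]
  -- the intertwining relation, multiplied by `t`
  have h1 : A * swapMatrix t = swapMatrix t * γ.val := by
    apply smul_matrix_cancel ht
    calc (t : ℤ) • (A * swapMatrix t)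
        = ((t : ℤ) • swapSign) * (γ⁻¹).valᵀ * (swapSignᵀ * swapMatrix t) := by
          rw [hA, Matrix.smul_mul, Matrix.smul_mul]; simp only [Matrix.mul_assoc]
      _ = swapMatrix t * (γ.val * formMatrix t) * (swapSignᵀ * swapMatrix t) := by
          rw [← swapMatrix_mul_formMatrix, hcomm]; simp only [Matrix.mul_assoc]
      _ = swapMatrix t * γ.val * (formMatrix t * (swapSignᵀ * swapMatrix t)) := by
          simp only [Matrix.mul_assoc]
      _ = (t : ℤ) • (swapMatrix t * γ.val) := by
          rw [hΛ, Matrix.mul_smul, Matrix.mul_one]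
  have h2 : γ.val * swapMatrix t = swapMatrix t * A := by
    apply smul_matrix_cancel ht
    calc (t : ℤ) • (γ.val * swapMatrix t)
        = swapMatrix t * swapMatrix t * γ.val * swapMatrix t := by
          rw [swapMatrix_mul_self, Matrix.smul_mul, Matrix.one_mul, Matrix.smul_mul]
      _ = swapMatrix t * A * (swapMatrix t * swapMatrix t) := by
          rw [Matrix.mul_assoc (swapMatrix t) (swapMatrix t) γ.val, ← h1]
          simp only [Matrix.mul_assoc]
      _ = (t : ℤ) • (swapMatrix t * A) := by
          rw [swapMatrix_mul_self, Matrix.mul_smul, Matrix.mul_one]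
  have h3 : A * formMatrix t * Aᵀ = formMatrix t := by
    apply smul_matrix_cancel ht
    calc (t : ℤ) • (A * formMatrix t * Aᵀ)
        = A * (swapMatrix t * formMatrix t * (swapMatrix t)ᵀ) * Aᵀ := by
          rw [swapMatrix_form, Matrix.mul_smul, Matrix.smul_mul]
      _ = (A * swapMatrix t) * formMatrix t * (A * swapMatrix t)ᵀ := by
          rw [transpose_mul A (swapMatrix t)]; simp only [Matrix.mul_assoc]
      _ = swapMatrix t * (γ.val * formMatrix t * γ.valᵀ) * (swapMatrix t)ᵀ := by
          rw [h1, transpose_mul]; simp only [Matrix.mul_assoc]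
      _ = (t : ℤ) • formMatrix t := by rw [hform, swapMatrix_form]
  have h4 : A.map (Int.cast : ℤ → ZMod n) = 1 := by
    have hmul : ∀ M N : Matrix (Fin 4) (Fin 4) ℤ, (M * N).map (Int.cast : ℤ → ZMod n) =
        M.map Int.cast * N.map Int.cast := fun M N =>
      Matrix.map_mul (f := Int.castRingHom (ZMod n))
    rw [hA, hmul, hmul, transpose_map, hinv, transpose_one, Matrix.mul_one, ← hmul,
      swapSign_mul_transpose, Matrix.map_one _ Int.cast_zero Int.cast_one]
  obtain ⟨γ', hγ', hval⟩ := exists_mem_levelGroup ht A h3 h4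
  exact ⟨γ', hγ', by rw [hval, h1], by rw [hval, h2]⟩

/-- The similitude of `ℚ⁴` given by the swap matrix. -/
def swapEquiv {t : ℕ} (ht : t ≠ 0) : (Fin 4 → ℚ) ≃ₗ[ℚ] (Fin 4 → ℚ) :=
  have h : ∀ v : Fin 4 → ℚ,
      (v ᵥ* (swapMatrix t).map (Int.cast : ℤ → ℚ)) ᵥ* (swapMatrix t).map (Int.cast : ℤ → ℚ) =
        (t : ℚ) • v := fun v => by
    have h1 : ((t : ℤ) • (1 : Matrix (Fin 4) (Fin 4) ℤ)).map (Int.cast : ℤ → ℚ) =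
        (t : ℚ) • (1 : Matrix (Fin 4) (Fin 4) ℚ) := by
      ext i j
      rw [Matrix.map_apply, Matrix.smul_apply, Matrix.smul_apply, one_apply, one_apply]
      split_ifs <;> simp
    rw [vecMul_vecMul, ← map_cast_mul, swapMatrix_mul_self, h1, vecMul_smul, vecMul_one]
  have ht' : (t : ℚ) ≠ 0 := by exact_mod_cast ht
  LinearEquiv.ofLinearMap (vecMulLinear ((swapMatrix t).map Int.cast))
    ((t : ℚ)⁻¹ • vecMulLinear ((swapMatrix t).map Int.cast))
    (LinearMap.ext fun v => by
      rw [LinearMap.comp_apply, LinearMap.smul_apply, map_smul, vecMulLinear_apply,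
        vecMulLinear_apply, h, smul_smul, inv_mul_cancel₀ ht', one_smul, LinearMap.id_apply])
    (LinearMap.ext fun v => by
      rw [LinearMap.comp_apply, LinearMap.smul_apply, vecMulLinear_apply,
        vecMulLinear_apply, h, smul_smul, inv_mul_cancel₀ ht', one_smul, LinearMap.id_apply])

theorem swapEquiv_apply {t : ℕ} (ht : t ≠ 0) (v : Fin 4 → ℚ) :
    swapEquiv ht v = v ᵥ* (swapMatrix t).map (Int.cast : ℤ → ℚ) := rfl

theorem swapEquiv_intVec {t : ℕ} (ht : t ≠ 0) (v : Fin 4 → ℤ) :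
    swapEquiv ht (intVec v) = intVec ![t * v 1, v 0, t * v 3, v 2] := by
  rw [swapEquiv_apply, intVec_vecMul, vecMul_swapMatrix]

theorem isSimilitude_swapEquiv {t n : ℕ} (ht : t ≠ 0) :
    IsSimilitude t (levelGroup t n) (swapEquiv ht) where
  form := by
    refine ⟨t, by exact_mod_cast ht, fun v w => ?_⟩
    have h : ∀ v : Fin 4 → ℚ, swapEquiv ht v = ![t * v 1, v 0, t * v 3, v 2] := fun v => by
      rw [swapEquiv_apply]
      ext j
      fin_cases j <;> simp [swapMatrix, vecMul, dotProduct, Fin.sum_univ_four, mul_comm]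
    rw [ratForm_eq, ratForm_eq, h, h]
    simp only [cons_val]
    ring
  conj γ hγ := by
    obtain ⟨γ', hγ', -, h⟩ := exists_levelGroup_mul_swapMatrix ht hγ
    refine ⟨γ', hγ', fun v => ?_⟩
    simp only [rowEquiv_apply, swapEquiv_apply, vecMul_vecMul, ← map_cast_mul, h]
  conj_symm γ hγ := by
    obtain ⟨γ', hγ', h, -⟩ := exists_levelGroup_mul_swapMatrix ht hγ
    refine ⟨γ', hγ', fun v => ?_⟩
    simp only [rowEquiv_apply, swapEquiv_apply, vecMul_vecMul, ← map_cast_mul, h]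

/-! ### Primitive vectors and the classification of isotropic subspaces -/

/-- Every nonzero rational vector is proportional to a primitive integral one. -/
theorem exists_primitive {ι : Type*} [Fintype ι] {v : ι → ℚ} (hv : v ≠ 0) :
    ∃ w x : ι → ℤ, x ⬝ᵥ w = 1 ∧ ∃ c : ℚ, c ≠ 0 ∧ v = c • intVec w := by
  classical
  obtain ⟨⟨b, hb⟩, hbv⟩ := IsLocalization.exist_integer_multiples_of_finite (nonZeroDivisors ℤ) v
  choose u hu using hbv
  have hb0 : (b : ℚ) ≠ 0 := by exact_mod_cast nonZeroDivisors.ne_zero hb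
  have hu' : ∀ i, (u i : ℚ) = b * v i := fun i => by simpa using hu i
  obtain ⟨i0, hi0⟩ := Function.ne_iff.1 hv
  obtain ⟨w, hw, hw1⟩ := Finset.extract_gcd u ⟨i0, Finset.mem_univ i0⟩
  have hg : Finset.univ.gcd u ≠ 0 := by
    intro h
    have h0 := Finset.gcd_eq_zero_iff.1 h i0 (Finset.mem_univ _)
    have := hu' i0
    rw [h0] at this
    rcases mul_eq_zero.1 (this.symm.trans Int.cast_zero) with h | h
    · exact hb0 h
    · exact hi0 h
  obtain ⟨x, hx⟩ : ∃ x : ι → ℤ, x ⬝ᵥ w = 1 := by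
    have h1 : (1 : ℤ) ∈ Ideal.span (Set.range w) := by
      obtain ⟨d, hd⟩ := IsPrincipalIdealRing.principal (Ideal.span (Set.range w))
      have hdvd : d ∣ Finset.univ.gcd w := Finset.dvd_gcd fun i _ => by
        rw [← Ideal.mem_span_singleton]
        have : w i ∈ Ideal.span (Set.range w) := Ideal.subset_span ⟨i, rfl⟩
        rw [hd] at this
        exact this
      rw [hd]
      exact Ideal.mem_span_singleton.2 (hw1 ▸ hdvd)
    obtain ⟨x, hx⟩ := (Submodule.mem_span_range_iff_exists_fun ℤ).1 h1
    exact ⟨x, by simpa [dotProduct] using hx⟩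
  refine ⟨w, x, hx, ((Finset.univ.gcd u : ℤ) : ℚ) / b, div_ne_zero (by exact_mod_cast hg) hb0, ?_⟩
  ext i
  have h1 := hu' i
  rw [hw i (Finset.mem_univ i)] at h1
  push_cast at h1
  simp only [Pi.smul_apply, intVec, smul_eq_mul]
  field_simp
  linarith

/-- A primitive vector has divisor one, or is the swap of a vector of divisor one. -/
theorem hasDivisorOne_or_eq_swap {p : ℕ} (hp : p.Prime) {w x : Fin 4 → ℤ} (h : x ⬝ᵥ w = 1) :
    HasDivisorOne p w ∨
      ∃ u : Fin 4 → ℤ, HasDivisorOne p u ∧ w = ![p * u 1, u 0, p * u 3, u 2] := by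
  have h' : x 0 * w 0 + x 1 * w 1 + x 2 * w 2 + x 3 * w 3 = 1 := by
    simpa [dotProduct, Fin.sum_univ_four] using h
  by_cases hd : (p : ℤ) ∣ w 0 ∧ (p : ℤ) ∣ w 2
  · obtain ⟨⟨a, ha⟩, c, hc⟩ := hd
    refine Or.inr ⟨![w 1, a, w 3, c], hasDivisorOne_iff.2 ⟨x 1, x 3, x 0, x 2, ?_⟩, ?_⟩
    · rw [ha, hc] at h'
      simp
      linarith
    · ext j
      fin_cases j <;> simp [ha, hc]
  · left
    -- the ideals `(w₀, w₂)` and `(p) · (w₁, w₃)` are coprime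
    have h1 : IsCoprime (Int.gcd (w 0) (w 2) : ℤ) p := by
      refine ((Nat.prime_iff_prime_int.1 hp).coprime_iff_not_dvd.2 fun hdvd => hd
        ⟨hdvd.trans (Int.gcd_dvd_left ..), hdvd.trans (Int.gcd_dvd_right ..)⟩).symm
    have h2 : IsCoprime (Int.gcd (w 0) (w 2) : ℤ) (x 1 * w 1 + x 3 * w 3) := by
      obtain ⟨a, ha⟩ : (Int.gcd (w 0) (w 2) : ℤ) ∣ x 0 * w 0 + x 2 * w 2 :=
        dvd_add ((Int.gcd_dvd_left ..).mul_left _) ((Int.gcd_dvd_right ..).mul_left _)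
      exact ⟨a, 1, by linarith⟩
    obtain ⟨r, s, hrs⟩ := h1.mul_right h2
    refine hasDivisorOne_iff.2 ⟨r * Int.gcdA (w 0) (w 2), r * Int.gcdB (w 0) (w 2), s * x 1,
      s * x 3, ?_⟩
    rw [Int.gcd_eq_gcd_ab] at hrs
    linear_combination hrs

/-- The standard isotropic line `⟨e₀⟩`. -/
def stdLine : Submodule ℚ (Fin 4 → ℚ) := ℚ ∙ intVec ![1, 0, 0, 0]

/-- The isotropic plane `⟨e₀, y e₁ + z e₃⟩`. -/
def stdPlane (y z : ℤ) : Submodule ℚ (Fin 4 → ℚ) :=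
  Submodule.span ℚ {intVec ![1, 0, 0, 0], intVec ![0, y, 0, z]}

theorem isIsotropic_stdPlane (t : ℕ) (y z : ℤ) : IsIsotropic t (stdPlane y z) := by
  intro v hv w hw
  change ratForm t v w = 0
  obtain ⟨a, b, rfl⟩ := Submodule.mem_span_pair.1 hv
  obtain ⟨c, d, rfl⟩ := Submodule.mem_span_pair.1 hw
  simp [ratForm_eq, intVec]
  right
  ring

theorem intVec_mem_stdPlane (y z : ℤ) : intVec ![1, 0, 0, 0] ∈ stdPlane y z :=
  Submodule.subset_span (Set.mem_insert _ _)

theorem stdLine_le_stdPlane (y z : ℤ) : stdLine ≤ stdPlane y z :=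
  (Submodule.span_singleton_le_iff_mem _ _).2 (intVec_mem_stdPlane y z)

theorem finrank_stdLine : Module.finrank ℚ stdLine = 1 :=
  finrank_span_singleton fun h => by simpa [intVec] using congrFun h 0

theorem finrank_stdPlane {y z : ℤ} (h : IsCoprime y z) : Module.finrank ℚ (stdPlane y z) = 2 := by
  have hli : LinearIndependent ℚ ![intVec ![1, 0, 0, 0], intVec ![0, y, 0, z]] := by
    rw [LinearIndependent.pair_iff]
    intro a b hab
    have h0 := congrFun hab 0
    have h1 := congrFun hab 1
    have h3 := congrFun hab 3
    simp [intVec] at h0 h1 h3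
    refine ⟨h0, ?_⟩
    by_contra hb
    have hy := h1.resolve_left hb
    have hz := h3.resolve_left hb
    rw [hy, hz] at h
    exact not_isUnit_zero (isCoprime_zero_left.1 h)
  have := finrank_span_eq_card hli
  rwa [Matrix.range_cons, Matrix.range_cons, Matrix.range_empty, Set.union_empty,
    Set.singleton_union, Fintype.card_fin] at this

theorem mem_of_eq_smul {ι : Type*} {U : Submodule ℚ (ι → ℚ)} {u v : ι → ℚ} {c : ℚ} (hc : c ≠ 0)
    (hu : u ∈ U) (h : u = c • v) : v ∈ U := by
  have := U.smul_mem c⁻¹ hu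
  rwa [h, smul_smul, inv_mul_cancel₀ hc, one_smul] at this

/-- The isotropic subspaces containing `e₀`. -/
theorem eq_stdLine_or_eq_stdPlane {t : ℕ} (ht : t ≠ 0) {U : Submodule ℚ (Fin 4 → ℚ)}
    (hU : IsIsotropic t U) (h0 : intVec ![1, 0, 0, 0] ∈ U) :
    U = stdLine ∨ ∃ y z : ℤ, IsCoprime y z ∧ U = stdPlane y z := by
  have h2 : ∀ u ∈ U, u 2 = 0 := fun u hu => by
    have : ratForm t (intVec ![1, 0, 0, 0]) u = 0 := hU _ h0 u hu
    simpa [ratForm_eq, intVec] using this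
  by_cases hline : ∀ u ∈ U, u 1 = 0 ∧ u 3 = 0
  · left
    apply le_antisymm
    · intro u hu
      refine Submodule.mem_span_singleton.2 ⟨u 0, ?_⟩
      ext j
      fin_cases j <;> simp [intVec, h2 u hu, (hline u hu).1, (hline u hu).2]
    · exact (Submodule.span_singleton_le_iff_mem _ _).2 h0
  · right
    push Not at hline
    obtain ⟨u, hu, hne⟩ := hline
    have hv : (![u 1, u 3] : Fin 2 → ℚ) ≠ 0 := fun h => by
      have h1 := congrFun h 0
      have h3 := congrFun h 1
      exact hne (by simpa using h1) (by simpa using h3)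
    obtain ⟨w, x, hx, c, hc, hw⟩ := exists_primitive hv
    have hx' : x 0 * w 0 + x 1 * w 1 = 1 := by simpa [dotProduct, Fin.sum_univ_two] using hx
    have hxq : (x 0 : ℚ) * w 0 + x 1 * w 1 = 1 := by exact_mod_cast hx'
    have hw0 : u 1 = c * w 0 := by simpa [intVec] using congrFun hw 0
    have hw1 : u 3 = c * w 1 := by simpa [intVec] using congrFun hw 1
    have hf : intVec ![0, w 0, 0, w 1] ∈ U := by
      refine mem_of_eq_smul hc (U.sub_mem hu (U.smul_mem (u 0) h0)) ?_
      ext j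
      fin_cases j <;> simp [intVec, h2 u hu, hw0, hw1]
    refine ⟨w 0, w 1, ⟨x 0, x 1, hx'⟩, le_antisymm ?_ ?_⟩
    · intro v hv
      have hvf : ratForm t (intVec ![0, w 0, 0, w 1]) v = 0 := hU _ hf v hv
      have ht' : (t : ℚ) ≠ 0 := by exact_mod_cast ht
      have hvf' : (w 0 : ℚ) * v 3 - w 1 * v 1 = 0 := by
        have : (t : ℚ) * (w 0 * v 3 - w 1 * v 1) = 0 := by
          simpa [ratForm_eq, intVec] using hvf
        exact (mul_eq_zero.1 this).resolve_left ht'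
      refine Submodule.mem_span_pair.2 ⟨v 0, x 0 * v 1 + x 1 * v 3, ?_⟩
      ext j
      fin_cases j
      · simp [intVec]
      · simp [intVec]
        linear_combination v 1 * hxq + x 1 * hvf'
      · simp [intVec, h2 v hv]
      · simp [intVec]
        linear_combination v 3 * hxq - x 0 * hvf'
    · rw [stdPlane, Submodule.span_le, Set.insert_subset_iff, Set.singleton_subset_iff]
      exact ⟨h0, hf⟩

/-- `SL(2)` acts transitively on the isotropic planes through `e₀`, compatibly with congruences. -/
theorem exists_levelGroup_act_stdPlane {t n : ℕ} (ht : t ≠ 0) {y z y' z' : ℤ}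
    (h : IsCoprime y z) (h' : IsCoprime y' z') (hy : (y : ZMod n) = y') (hz : (z : ZMod n) = z') :
    ∃ γ ∈ levelGroup t n, act γ (stdPlane y z) = stdPlane y' z' := by
  obtain ⟨a, b, c, d, hdet, ha, hb, hc, hd, h1, h2⟩ := exists_sl_of_congruent h h' hy hz
  obtain ⟨γ, hγ, hv⟩ := exists_levelGroup_sl_one_three (t := t) ht hdet ha hb hc hd
  refine ⟨γ, hγ, ?_⟩
  rw [stdPlane, act_span_pair, hv, hv]
  simp [h1, h2, stdPlane]

/-- Up to similitudes normalizing the level group there are only two nontrivial isotropic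
subspaces: a line and a plane. -/
theorem exists_isSimilitude_map_eq {p n : ℕ} (hp : p.Prime) {U : Submodule ℚ (Fin 4 → ℚ)}
    (hU : IsIsotropic p U) (hne : U ≠ ⊥) :
    ∃ e : (Fin 4 → ℚ) ≃ₗ[ℚ] (Fin 4 → ℚ), IsSimilitude p (levelGroup p n) e ∧
      (U = stdLine.map (e : (Fin 4 → ℚ) →ₗ[ℚ] (Fin 4 → ℚ)) ∨
        U = (stdPlane 1 0).map (e : (Fin 4 → ℚ) →ₗ[ℚ] (Fin 4 → ℚ))) := by
  -- a similitude carrying `e₀` into `U`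
  obtain ⟨e, he, hmem⟩ : ∃ e : (Fin 4 → ℚ) ≃ₗ[ℚ] (Fin 4 → ℚ),
      IsSimilitude p (levelGroup p n) e ∧ e (intVec ![1, 0, 0, 0]) ∈ U := by
    obtain ⟨u, hu, hu0⟩ := U.exists_mem_ne_zero_of_ne_bot hne
    obtain ⟨w, x, hx, c, hc, hw⟩ := exists_primitive hu0
    have hwU := mem_of_eq_smul hc hu hw
    rcases hasDivisorOne_or_eq_swap hp hx with h | ⟨u, h, rfl⟩
    · obtain ⟨g, hg, rfl⟩ := exists_symplectic_vecMul_single_zero hp.two_le h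
      exact ⟨rowEquiv g, isSimilitude_rowEquiv hg, by rwa [rowEquiv_apply, intVec_vecMul]⟩
    · obtain ⟨g, hg, rfl⟩ := exists_symplectic_vecMul_single_zero hp.two_le h
      refine ⟨(rowEquiv g).trans (swapEquiv hp.ne_zero),
        (isSimilitude_rowEquiv hg).trans (isSimilitude_swapEquiv hp.ne_zero), ?_⟩
      rwa [LinearEquiv.trans_apply, rowEquiv_apply, intVec_vecMul, swapEquiv_intVec]
  have hUe : U = (U.comap (e : (Fin 4 → ℚ) →ₗ[ℚ] (Fin 4 → ℚ))).map
      (e : (Fin 4 → ℚ) →ₗ[ℚ] (Fin 4 → ℚ)) :=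
    (Submodule.map_comap_eq_of_surjective e.surjective U).symm
  have hiso := (he.isIsotropic_map_iff _).1 (hUe ▸ hU)
  rcases eq_stdLine_or_eq_stdPlane hp.ne_zero hiso hmem with h | ⟨y, z, hyz, h⟩
  · exact ⟨e, he, Or.inl (by rw [hUe, h])⟩
  · obtain ⟨g, hg, hgv⟩ := exists_levelGroup_act_stdPlane (t := p) (n := 1) hp.ne_zero
      (isCoprime_one_left (x := 0)) hyz (Subsingleton.elim _ _) (Subsingleton.elim _ _)
    refine ⟨(rowEquiv g).trans e, (isSimilitude_rowEquiv hg.1).trans he, Or.inr ?_⟩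
    rw [LinearEquiv.coe_trans, Submodule.map_comp, map_rowEquiv, hgv, ← h]
    exact hUe

/-! ### Counting modulo sign -/

/-- If the values of `g` on `J` determine those of `f` exactly up to sign, and the classes
`{f j, -f j}` all have `k` elements, then `f` takes `k` times as many values as `g`. -/
theorem ncard_image_eq_mul {ι A β : Type*} [AddGroup A] {J : Set ι} {f : ι → A} {g : ι → β}
    {k : ℕ} (hfin : (f '' J).Finite) (hneg : ∀ j ∈ J, -f j ∈ f '' J)
    (hk : ∀ j ∈ J, ({f j, -f j} : Set A).ncard = k)
    (h : ∀ i ∈ J, ∀ j ∈ J, g i = g j ↔ f i = f j ∨ f i = -f j) :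
    (f '' J).ncard = k * (g '' J).ncard := by
  classical
  have : Fintype (f '' J) := hfin.fintype
  choose σ hσJ hσ using fun a : f '' J => a.2
  let F : f '' J → β := fun a => g (σ a)
  have hF : ∀ j (hj : j ∈ J), F ⟨f j, j, hj, rfl⟩ = g j := fun j hj =>
    (h _ (hσJ _) _ hj).2 (Or.inl (hσ _))
  have himg : g '' J = (Finset.univ.image F : Finset β) := by
    ext b
    simp only [Set.mem_image, Finset.coe_image, Finset.coe_univ, Set.image_univ, Set.mem_range]
    constructor
    · rintro ⟨j, hj, rfl⟩
      exact ⟨_, hF j hj⟩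
    · rintro ⟨a, rfl⟩
      exact ⟨σ a, hσJ a, rfl⟩
  rw [himg, Set.ncard_coe_finset, ← Nat.card_coe_set_eq, Nat.card_eq_fintype_card,
    ← Finset.card_univ, Finset.card_eq_sum_card_image F Finset.univ, Finset.sum_const_nat, mul_comm]
  intro b hb
  obtain ⟨⟨_, j, hj, rfl⟩, -, rfl⟩ := Finset.mem_image.1 hb
  rw [← hk j hj, ← Finset.card_image_of_injective _ Subtype.val_injective, ← Set.ncard_coe_finset]
  congr 1
  ext a
  simp only [Finset.coe_image, Finset.coe_filter, Set.mem_image, Set.mem_ofPred_eq,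
    Finset.mem_univ, true_and, hF j hj, Set.mem_insert_iff, Set.mem_singleton_iff]
  constructor
  · rintro ⟨⟨_, i, hi, rfl⟩, hij, rfl⟩
    rw [hF i hi] at hij
    exact (h i hi j hj).1 hij
  · intro ha
    have ha' : a ∈ f '' J := by
      rcases ha with rfl | rfl
      · exact ⟨j, hj, rfl⟩
      · exact hneg j hj
    obtain ⟨i, hi, rfl⟩ := ha'
    exact ⟨⟨f i, i, hi, rfl⟩, by rw [hF i hi]; exact (h i hi j hj).2 ha, rfl⟩

/-- The number of elements of a class `{x, -x}`, `x ≠ 0`, in a vector space over `ℤ/q`. -/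
def signCard (q : ℕ) : ℕ := if q = 2 then 1 else 2

theorem ncard_pair_neg {q : ℕ} (hq : q.Prime) {A : Type*} [AddCommGroup A] [Module (ZMod q) A]
    {x : A} (hx : x ≠ 0) : ({x, -x} : Set A).ncard = signCard q := by
  have : Fact q.Prime := ⟨hq⟩
  unfold signCard
  split_ifs with h2
  · subst h2
    have : -x = x := by
      rw [neg_eq_iff_add_eq_zero, ← two_smul (ZMod 2) x, show (2 : ZMod 2) = 0 from rfl, zero_smul]
    rw [this, Set.pair_eq_singleton, Set.ncard_singleton]
  · refine Set.ncard_pair fun h => hx ?_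
    rw [eq_neg_iff_add_eq_zero, ← two_smul (ZMod q) x] at h
    refine (smul_eq_zero.1 h).resolve_left fun h => h2 ?_
    have h' : ((2 : ℕ) : ZMod q) = 0 := by exact_mod_cast h
    exact (Nat.prime_dvd_prime_iff_eq hq Nat.prime_two).1 ((ZMod.natCast_eq_zero_iff _ _).1 h')

/-- Coprime lifts of pairs of residues. -/
theorem exists_isCoprime_lift {q N : ℕ} (hq : q.Prime) (hN : N ≠ 0) {x y : ZMod q}
    (h : x ≠ 0 ∨ (¬ q ∣ N ∧ y ≠ 0)) :
    ∃ m n : ℤ, IsCoprime m (N * n) ∧ (m : ZMod q) = x ∧ (n : ZMod q) = y := by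
  have : NeZero q := ⟨hq.ne_zero⟩
  -- adding `q` makes the second lift nonzero
  have hn : ((y.val + q : ℕ) : ℤ) ≠ 0 := by have := hq.pos; omega
  obtain ⟨k, hk⟩ := exists_isCoprime_add_mul (a := N * (y.val + q : ℕ)) (b := x.val) (c := q)
    (mul_ne_zero (by exact_mod_cast hN) hn) (by
      intro r hr ha hb hc
      have hrq : r = q := (Nat.prime_dvd_prime_iff_eq hr hq).1 (Int.natCast_dvd_natCast.1 hc)
      subst hrq
      have hx : x = 0 := by
        rw [← ZMod.natCast_zmod_val x]
        exact (ZMod.natCast_eq_zero_iff _ _).2 (Int.natCast_dvd_natCast.1 hb)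
      obtain ⟨hrN, hy⟩ := h.resolve_left (not_not.2 hx)
      have ha' : r ∣ N * (y.val + r) := by exact_mod_cast ha
      refine hy ?_
      rw [← ZMod.natCast_zmod_val y]
      exact (ZMod.natCast_eq_zero_iff _ _).2
        ((Nat.dvd_add_left dvd_rfl).1 ((hr.dvd_mul.1 ha').resolve_left hrN)))
  exact ⟨_, _, hk.symm, by simp, by simp⟩

/-- The pairs `x` that occur as reductions modulo `q` of vectors of divisor one; the two components
of `x` are formed by coordinates in the unimodular plane and in the plane scaled by `p`. -/
def admissible (p q : ℕ) (A : Type*) [Zero A] : Set (A × A) :=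
  {x | x.1 ≠ 0 ∨ (¬ q ∣ p ∧ x.2 ≠ 0)}

theorem ncard_admissible_of_not_dvd {p q : ℕ} (h : ¬ q ∣ p) (A : Type*) [Zero A] [Finite A] :
    (admissible p q A).ncard = Nat.card A ^ 2 - 1 := by
  have : admissible p q A = {0}ᶜ := by
    ext x
    simp only [admissible, h, Set.mem_ofPred_eq, not_false_eq_true, true_and, Set.mem_compl_iff,
      Set.mem_singleton_iff, Prod.ext_iff, Prod.fst_zero, Prod.snd_zero]
    tauto
  rw [this, Set.ncard_compl, Set.ncard_singleton, Nat.card_prod, sq]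

theorem ncard_admissible_of_dvd {p q : ℕ} (h : q ∣ p) (A : Type*) [Zero A] [Finite A] :
    (admissible p q A).ncard = Nat.card A ^ 2 - Nat.card A := by
  have : admissible p q A = {0}ᶜ ×ˢ Set.univ := by
    ext x
    simp [admissible, h]
  rw [this, Set.ncard_prod, Set.ncard_compl, Set.ncard_singleton, Set.ncard_univ, Nat.sub_mul,
    one_mul, sq]

theorem neg_mem_admissible {p q : ℕ} {A : Type*} [AddGroup A] {x : A × A}
    (h : x ∈ admissible p q A) : -x ∈ admissible p q A := by
  simpa [admissible] using h

theorem ne_zero_of_mem_admissible {p q : ℕ} {A : Type*} [Zero A] {x : A × A}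
    (h : x ∈ admissible p q A) : x ≠ 0 := by
  rintro rfl
  simp [admissible] at h

/-! ### Orbits of lines -/

theorem eq_or_eq_neg_of_span_eq {ι : Type*} [Fintype ι] {v w x y : ι → ℤ} (hv : v ⬝ᵥ x = 1)
    (hw : w ⬝ᵥ y = 1) (h : (ℚ ∙ intVec v) = ℚ ∙ intVec w) : v = w ∨ v = -w := by
  have hmul : ∀ {v w x y : ι → ℤ}, v ⬝ᵥ x = 1 → w ⬝ᵥ y = 1 →
      (ℚ ∙ intVec v) = ℚ ∙ intVec w → ∃ c : ℤ, v = c • w := by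
    intro v w x y hv hw h
    have hmem : intVec v ∈ ℚ ∙ intVec w := h ▸ Submodule.mem_span_singleton_self _
    obtain ⟨c, hc⟩ := Submodule.mem_span_singleton.1 hmem
    have hdot : ∀ u : ι → ℤ, intVec u ⬝ᵥ intVec y = ((u ⬝ᵥ y : ℤ) : ℚ) := fun u => by
      simp [intVec, dotProduct]
    have hcv : c = ((v ⬝ᵥ y : ℤ) : ℚ) := by
      rw [← hdot, ← hc, smul_dotProduct, hdot, hw]
      simp
    refine ⟨v ⬝ᵥ y, intVec_injective ?_⟩
    rw [← hc, hcv]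
    ext i
    simp [intVec]
  obtain ⟨c, hc⟩ := hmul hv hw h
  obtain ⟨d, hd⟩ := hmul hw hv h.symm
  have hcd : c * d = 1 := by
    rw [hd, smul_smul] at hc
    have := congrArg (· ⬝ᵥ x) hc
    simp only [smul_dotProduct, hv, smul_eq_mul, mul_one] at this
    exact this.symm
  rcases Int.eq_one_or_neg_one_of_mul_eq_one hcd with rfl | rfl
  · exact Or.inl (by simpa using hc)
  · exact Or.inr (by simpa using hc)

theorem HasDivisorOne.ne_zero {t : ℕ} {v : Fin 4 → ℤ} (h : HasDivisorOne t v) : v ≠ 0 := by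
  rintro rfl
  obtain ⟨x, hx⟩ := h
  simp at hx

/-- The isotropic line spanned by a vector of divisor one. -/
def lineOf {t : ℕ} (v : {v : Fin 4 → ℤ // HasDivisorOne t v}) : IsotropicSubspace t :=
  ⟨ℚ ∙ intVec v.val, by
    constructor
    · intro u hu w hw
      obtain ⟨a, rfl⟩ := Submodule.mem_span_singleton.1 hu
      obtain ⟨b, rfl⟩ := Submodule.mem_span_singleton.1 hw
      change ratForm t _ _ = 0
      rw [ratForm_eq]
      simp only [Pi.smul_apply, smul_eq_mul]
      ring
    · rw [Ne, Submodule.span_singleton_eq_bot]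
      exact fun h => v.2.ne_zero (intVec_injective (h.trans (by ext; simp [intVec])))⟩

theorem coe_lineOf {t : ℕ} (v : {v : Fin 4 → ℤ // HasDivisorOne t v}) :
    (lineOf v).val = ℚ ∙ intVec v.val := rfl

theorem finrank_lineOf {t : ℕ} (v : {v : Fin 4 → ℤ // HasDivisorOne t v}) :
    Module.finrank ℚ (lineOf v).val = 1 :=
  finrank_span_singleton fun h =>
    v.2.ne_zero (intVec_injective (h.trans (by ext; simp [intVec])))

/-- Lines spanned by vectors of divisor one are classified by the reduction of a generator
up to sign. -/
theorem orbitOf_lineOf_eq_iff {t n : ℕ} (ht : 2 ≤ t) {v w : {v : Fin 4 → ℤ // HasDivisorOne t v}} :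
    orbitOf t (levelGroup t n) (lineOf v) = orbitOf t (levelGroup t n) (lineOf w) ↔
      (∀ i, (v.val i : ZMod n) = w.val i) ∨ (∀ i, (v.val i : ZMod n) = -w.val i) := by
  rw [orbitOf_eq_iff]
  constructor
  · rintro ⟨γ, hγ, h⟩
    rw [coe_lineOf, coe_lineOf, act_span_singleton] at h
    obtain ⟨x, hx⟩ := v.2.vecMul hγ.1
    obtain ⟨y, hy⟩ := w.2
    rcases eq_or_eq_neg_of_span_eq hx hy h with h | h
    · left
      intro i
      rw [← cast_vecMul_of_mem hγ, h]
    · right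
      intro i
      rw [← cast_vecMul_of_mem hγ, h]
      simp
  · rintro (h | h)
    · obtain ⟨γ, hγ, hv⟩ := exists_levelGroup_vecMul_eq ht v.2 w.2 h
      exact ⟨γ, hγ, by rw [coe_lineOf, coe_lineOf, act_span_singleton, hv]⟩
    · have hw : HasDivisorOne t (-w.val) := by
        obtain ⟨x, hx⟩ := w.2
        exact ⟨-x, by rw [mulVec_neg, neg_dotProduct_neg, hx]⟩
      obtain ⟨γ, hγ, hv⟩ := exists_levelGroup_vecMul_eq ht v.2 hw (by simpa using h)
      refine ⟨γ, hγ, ?_⟩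
      have : intVec (-w.val) = -intVec w.val := by ext; simp [intVec]
      rw [coe_lineOf, coe_lineOf, act_span_singleton, hv, this, ← Set.neg_singleton,
        Submodule.span_neg]

/-- The permutation of the vertices of the building given by the swap. -/
def swapOrbit {p : ℕ} (hp : p.Prime) (q : ℕ) :
    Orbit p (levelGroup p q) ≃ Orbit p (levelGroup p q) :=
  (isSimilitude_swapEquiv hp.ne_zero).orbitEquiv

/-- The swap of an isotropic subspace. -/
def swapSubspace {p : ℕ} (hp : p.Prime) : IsotropicSubspace p ≃ IsotropicSubspace p :=
  (isSimilitude_swapEquiv (n := 1) hp.ne_zero).subspaceEquiv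

theorem swapOrbit_orbitOf {p : ℕ} (hp : p.Prime) (q : ℕ) (U : IsotropicSubspace p) :
    swapOrbit hp q (orbitOf p (levelGroup p q) U) =
      orbitOf p (levelGroup p q) (swapSubspace hp U) := rfl

theorem coe_swapSubspace_lineOf {p : ℕ} (hp : p.Prime) (v : {v : Fin 4 → ℤ // HasDivisorOne p v}) :
    (swapSubspace hp (lineOf v)).val =
      ℚ ∙ intVec ![p * v.val 1, v.val 0, p * v.val 3, v.val 2] := by
  change Submodule.map _ (ℚ ∙ intVec v.val) = _
  rw [Submodule.map_span, Set.image_singleton]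
  exact congrArg (fun u => ℚ ∙ u) (swapEquiv_intVec hp.ne_zero v.val)

theorem finrank_swapSubspace {p : ℕ} (hp : p.Prime) (U : IsotropicSubspace p) :
    Module.finrank ℚ (swapSubspace hp U).val = Module.finrank ℚ U.val :=
  (isSimilitude_swapEquiv (n := 1) hp.ne_zero).finrank_subspaceEquiv U

theorem orbitOf_lineOf_ne_swapOrbit {p : ℕ} (hp : p.Prime) (q : ℕ)
    (v w : {v : Fin 4 → ℤ // HasDivisorOne p v}) :
    orbitOf p (levelGroup p q) (lineOf v) ≠
      swapOrbit hp q (orbitOf p (levelGroup p q) (lineOf w)) := by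
  rw [swapOrbit_orbitOf, Ne, orbitOf_eq_iff]
  rintro ⟨γ, hγ, h⟩
  rw [coe_lineOf, coe_swapSubspace_lineOf, act_span_singleton] at h
  have hv := v.2.vecMul hγ.1
  obtain ⟨x, hx⟩ := id hv
  obtain ⟨a, b, c, d, hw⟩ := hasDivisorOne_iff.1 w.2
  have hw' : ![p * w.val 1, w.val 0, p * w.val 3, w.val 2] ⬝ᵥ ![c, a, d, b] = 1 := by
    simp [dotProduct, Fin.sum_univ_four]
    linarith
  obtain ⟨a', b', c', d', hv'⟩ := hasDivisorOne_iff.1 hv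
  have hunit : ¬ (p : ℤ) ∣ 1 := (Nat.prime_iff_prime_int.1 hp).not_dvd_one
  rcases eq_or_eq_neg_of_span_eq hx hw' h with h | h <;> rw [h] at hv' <;>
    simp only [Pi.neg_apply, cons_val] at hv' <;> rw [← hv'] at hunit
  · exact hunit ⟨a' * w.val 1 + b' * w.val 3 + c' * w.val 0 + d' * w.val 2, by ring⟩
  · exact hunit ⟨-(a' * w.val 1 + b' * w.val 3 + c' * w.val 0 + d' * w.val 2), by ring⟩

/-- An isotropic line is spanned by a vector of divisor one or by the swap of one. -/
theorem exists_lineOf_eq_or_swap {p : ℕ} (hp : p.Prime) {U : IsotropicSubspace p}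
    (hU : Module.finrank ℚ U.val = 1) :
    ∃ v : {v : Fin 4 → ℤ // HasDivisorOne p v}, U = lineOf v ∨ U = swapSubspace hp (lineOf v) := by
  obtain ⟨u, hu, hu0⟩ := U.val.exists_mem_ne_zero_of_ne_bot U.2.2
  obtain ⟨w, x, hx, c, hc, hw⟩ := exists_primitive hu0
  have hwU := mem_of_eq_smul hc hu hw
  have heq : ∀ w : Fin 4 → ℤ, x ⬝ᵥ w = 1 → intVec w ∈ U.val → U.val = ℚ ∙ intVec w := by
    intro w hx hwU
    refine (Submodule.eq_of_le_of_finrank_eq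
      ((Submodule.span_singleton_le_iff_mem _ _).2 hwU) ?_).symm
    rw [hU]
    refine finrank_span_singleton fun h => ?_
    have : w = 0 := intVec_injective (h.trans (by ext; simp [intVec]))
    simp [this] at hx
  rcases hasDivisorOne_or_eq_swap hp hx with h | ⟨v, h, rfl⟩
  · exact ⟨⟨w, h⟩, Or.inl (Subtype.ext (heq w hx hwU))⟩
  · refine ⟨⟨v, h⟩, Or.inr (Subtype.ext ?_)⟩
    rw [coe_swapSubspace_lineOf]
    exact heq _ hx hwU

theorem lineOrbits_eq {p : ℕ} (hp : p.Prime) (q : ℕ) :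
    lineOrbits p (levelGroup p q) =
      (fun v => orbitOf p (levelGroup p q) (lineOf v)) '' Set.univ ∪
        swapOrbit hp q '' ((fun v => orbitOf p (levelGroup p q) (lineOf v)) '' Set.univ) := by
  ext x
  constructor
  · rintro ⟨U, rfl, hU⟩
    obtain ⟨v, rfl | rfl⟩ := exists_lineOf_eq_or_swap hp hU
    · exact Or.inl ⟨v, trivial, rfl⟩
    · exact Or.inr ⟨_, ⟨v, trivial, rfl⟩, rfl⟩
  · rintro (⟨v, -, rfl⟩ | ⟨_, ⟨v, -, rfl⟩, rfl⟩)
    · exact ⟨lineOf v, rfl, finrank_lineOf v⟩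
    · exact ⟨swapSubspace hp (lineOf v), rfl, by rw [finrank_swapSubspace, finrank_lineOf]⟩

/-- The swap doubles the number of orbits in a set of orbits of lines of divisor one. -/
theorem ncard_union_swapOrbit {p : ℕ} (hp : p.Prime) (q : ℕ)
    {J : Set {v : Fin 4 → ℤ // HasDivisorOne p v}} {s : Set (Orbit p (levelGroup p q))}
    (hs : s = (fun v => orbitOf p (levelGroup p q) (lineOf v)) '' J) (hfin : s.Finite) :
    (s ∪ swapOrbit hp q '' s).ncard = 2 * s.ncard := by
  rw [Set.ncard_union_eq _ hfin (hfin.image _),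
    Set.ncard_image_of_injective _ (swapOrbit hp q).injective, two_mul]
  rw [Set.disjoint_left, hs]
  rintro _ ⟨v, -, rfl⟩ ⟨_, ⟨w, -, rfl⟩, h⟩
  exact orbitOf_lineOf_ne_swapOrbit hp q v w h.symm

theorem mem_admissible_of_hasDivisorOne {p q : ℕ} (hq : q.Prime) {v : Fin 4 → ℤ}
    (hv : HasDivisorOne p v) :
    (((v 0 : ZMod q), (v 2 : ZMod q)), ((v 1 : ZMod q), (v 3 : ZMod q))) ∈
      admissible p q (ZMod q × ZMod q) := by
  have : Fact q.Prime := ⟨hq⟩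
  obtain ⟨a, b, c, d, h⟩ := hasDivisorOne_iff.1 hv
  have h' := congrArg (Int.cast : ℤ → ZMod q) h
  push_cast at h'
  simp only [admissible, Set.mem_ofPred_eq]
  by_contra hcon
  rw [not_or, not_and, not_not, not_not] at hcon
  have h0 := congrArg Prod.fst hcon.1
  have h2 := congrArg Prod.snd hcon.1
  simp only [Prod.fst_zero, Prod.snd_zero] at h0 h2
  by_cases hd : q ∣ p
  · rw [h0, h2, (ZMod.natCast_eq_zero_iff _ _).2 hd] at h'
    simp at h'
  · have h1 := congrArg Prod.fst (hcon.2 hd)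
    have h3 := congrArg Prod.snd (hcon.2 hd)
    simp only [Prod.fst_zero, Prod.snd_zero] at h1 h3
    rw [h0, h1, h2, h3] at h'
    simp at h'

theorem image_lineOf_residues {p q : ℕ} (hq : q.Prime) :
    (fun v : {v : Fin 4 → ℤ // HasDivisorOne p v} =>
      (((v.val 0 : ZMod q), (v.val 2 : ZMod q)), ((v.val 1 : ZMod q), (v.val 3 : ZMod q)))) ''
        Set.univ = admissible p q (ZMod q × ZMod q) := by
  ext ⟨⟨x0, x2⟩, x1, x3⟩
  constructor
  · rintro ⟨v, -, h⟩
    rw [← h]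
    exact mem_admissible_of_hasDivisorOne hq v.2
  · intro h
    have hone : ¬ q ∣ 1 := hq.one_lt.ne' ∘ Nat.dvd_one.1
    have lift : ∀ {x y : ZMod q}, (x, y) ≠ 0 →
        ∃ m n : ℤ, IsCoprime m n ∧ (m : ZMod q) = x ∧ (n : ZMod q) = y := by
      intro x y hxy
      obtain ⟨m, n, hmn, hm, hn⟩ := exists_isCoprime_lift (N := 1) hq one_ne_zero (x := x) (y := y)
        (by
          by_cases hx : x = 0
          · exact Or.inr ⟨hone, fun hy => hxy (by rw [hx, hy]; rfl)⟩
          · exact Or.inl hx)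
      exact ⟨m, n, by simpa using hmn, hm, hn⟩
    by_cases h02 : (x0, x2) = (0 : ZMod q × ZMod q)
    · obtain ⟨hqp, h13⟩ := h.resolve_left (not_not.2 h02)
      obtain ⟨m, n, ⟨r, s, hrs⟩, hm, hn⟩ := lift h13
      obtain ⟨a, b, hab⟩ : IsCoprime (q : ℤ) p :=
        Nat.isCoprime_iff_coprime.2 ((Nat.Prime.coprime_iff_not_dvd hq).2 hqp)
      refine ⟨⟨![q, m, 0, n], hasDivisorOne_iff.2 ⟨a, 0, b * r, b * s, ?_⟩⟩, trivial, ?_⟩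
      · simp
        linear_combination hab + p * b * hrs
      · simp only [Prod.mk_eq_zero] at h02
        simp [hm, hn, h02]
    · obtain ⟨m, n, ⟨r, s, hrs⟩, hm, hn⟩ := lift h02
      refine ⟨⟨![m, (x1.cast : ℤ), n, (x3.cast : ℤ)],
        hasDivisorOne_iff.2 ⟨r, s, 0, 0, ?_⟩⟩, trivial, ?_⟩
      · simpa using hrs
      · simp [hm, hn]

theorem signCard_mul_ncard_lineOf {p q : ℕ} (hp : p.Prime) (hq : q.Prime) :
    signCard q * ((fun v => orbitOf p (levelGroup p q) (lineOf v)) '' Set.univ).ncard =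
      (admissible p q (ZMod q × ZMod q)).ncard := by
  have : NeZero q := ⟨hq.ne_zero⟩
  rw [← image_lineOf_residues hq]
  refine (ncard_image_eq_mul (Set.toFinite _) ?_ ?_ ?_).symm
  · intro v _
    rw [image_lineOf_residues hq]
    exact neg_mem_admissible (mem_admissible_of_hasDivisorOne hq v.2)
  · intro v _
    exact ncard_pair_neg hq (ne_zero_of_mem_admissible (mem_admissible_of_hasDivisorOne hq v.2))
  · intro v _ w _
    rw [orbitOf_lineOf_eq_iff hp.two_le]
    simp only [Fin.forall_fin_succ, Fin.isValue, Prod.ext_iff, Prod.neg_mk]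
    simp
    tauto

/-! ### The neighbours of the standard line -/

/-- The plane `⟨e₀, y e₁ + z e₃⟩` as an isotropic subspace. -/
def planeOf (t : ℕ) (y : ℤ × ℤ) : IsotropicSubspace t :=
  ⟨stdPlane y.1 y.2, isIsotropic_stdPlane t _ _, fun h => by
    have h0 := intVec_mem_stdPlane y.1 y.2
    rw [h, Submodule.mem_bot] at h0
    simpa [intVec] using congrFun h0 0⟩

theorem coe_planeOf (t : ℕ) (y : ℤ × ℤ) : (planeOf t y).val = stdPlane y.1 y.2 := rfl

theorem eq_of_intVec_mem_stdPlane {y z r s : ℤ} (h : r * y + s * z = 1) {u : Fin 4 → ℤ}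
    (hu : intVec u ∈ stdPlane y z) :
    u = u 0 • ![1, 0, 0, 0] + (r * u 1 + s * u 3) • ![0, y, 0, z] := by
  obtain ⟨a, b, hab⟩ := Submodule.mem_span_pair.1 hu
  have h0 := congrFun hab 0
  have h1 := congrFun hab 1
  have h2 := congrFun hab 2
  have h3 := congrFun hab 3
  simp [intVec] at h0 h1 h2 h3
  have hb : ((r * u 1 + s * u 3 : ℤ) : ℚ) = b := by
    have hq : (r : ℚ) * y + s * z = 1 := by exact_mod_cast h
    push_cast
    rw [← h1, ← h3]
    linear_combination b * hq
  rw [← hb] at h1 h3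
  ext j
  fin_cases j
  · simp
  · simpa using (by exact_mod_cast h1.symm)
  · simpa using h2.symm
  · simpa using (by exact_mod_cast h3.symm)

/-- The planes through `e₀` are classified by the reduction of `(y, z)` up to sign: an equivalence
and its inverse act on integral bases by integral `2 × 2` matrices, so their determinants are `±1`,
and modulo `n` this determinant is the factor between the two residues. -/
theorem orbitOf_planeOf_eq_iff {t n : ℕ} (ht : t ≠ 0) {y y' : ℤ × ℤ} (hy : IsCoprime y.1 y.2)
    (hy' : IsCoprime y'.1 y'.2) :
    orbitOf t (levelGroup t n) (planeOf t y) = orbitOf t (levelGroup t n) (planeOf t y') ↔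
      ((y.1 : ZMod n), (y.2 : ZMod n)) = ((y'.1 : ZMod n), (y'.2 : ZMod n)) ∨
        ((y.1 : ZMod n), (y.2 : ZMod n)) = -((y'.1 : ZMod n), (y'.2 : ZMod n)) := by
  obtain ⟨y, z⟩ := y
  obtain ⟨y', z'⟩ := y'
  simp only [orbitOf_eq_iff, coe_planeOf] at hy hy' ⊢
  constructor
  · rintro ⟨γ, hγ, h⟩
    obtain ⟨r, s, hrs⟩ := id hy
    obtain ⟨r', s', hrs'⟩ := id hy'
    have hback : act γ⁻¹ (stdPlane y' z') = stdPlane y z := by rw [← h, act_inv_act]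
    set e : Fin 4 → ℤ := ![1, 0, 0, 0] with he
    set f : Fin 4 → ℤ := ![0, y, 0, z] with hf
    set f' : Fin 4 → ℤ := ![0, y', 0, z'] with hf'
    have hfmem : ∀ y z : ℤ, intVec ![0, y, 0, z] ∈ stdPlane y z := fun y z =>
      Submodule.subset_span (Set.mem_insert_of_mem _ rfl)
    -- the matrices of `γ` and `γ⁻¹` in the bases `e, f` and `e, f'`
    obtain ⟨α, β, hαβ⟩ : ∃ α β : ℤ, e ᵥ* γ.val = α • e + β • f' :=
      ⟨_, _, eq_of_intVec_mem_stdPlane hrs' (h ▸ mem_act_of_mem (intVec_mem_stdPlane y z))⟩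
    obtain ⟨c, d, hcd⟩ : ∃ c d : ℤ, f ᵥ* γ.val = c • e + d • f' :=
      ⟨_, _, eq_of_intVec_mem_stdPlane hrs' (h ▸ mem_act_of_mem (hfmem y z))⟩
    obtain ⟨α', β', hαβ'⟩ : ∃ α β : ℤ, e ᵥ* (γ⁻¹).val = α • e + β • f :=
      ⟨_, _, eq_of_intVec_mem_stdPlane hrs (hback ▸ mem_act_of_mem (intVec_mem_stdPlane y' z'))⟩
    obtain ⟨c', d', hcd'⟩ : ∃ c d : ℤ, f' ᵥ* (γ⁻¹).val = c • e + d • f :=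
      ⟨_, _, eq_of_intVec_mem_stdPlane hrs (hback ▸ mem_act_of_mem (hfmem y' z'))⟩
    have hinv : ∀ v : Fin 4 → ℤ, (v ᵥ* γ.val) ᵥ* (γ⁻¹).val = v := fun v => by
      rw [vecMul_vecMul, ← Units.val_mul, mul_inv_cancel, Units.val_one, vecMul_one]
    have hE := hinv e
    rw [hαβ, add_vecMul, smul_vecMul, smul_vecMul, hαβ', hcd'] at hE
    have hF := hinv f
    rw [hcd, add_vecMul, smul_vecMul, smul_vecMul, hαβ', hcd'] at hF
    have hE0 := congrFun hE 0
    have hE1 := congrFun hE 1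
    have hE3 := congrFun hE 3
    have hF0 := congrFun hF 0
    have hF1 := congrFun hF 1
    have hF3 := congrFun hF 3
    simp only [he, hf, Pi.add_apply, Pi.smul_apply, smul_eq_mul, cons_val, mul_one, mul_zero,
      add_zero, zero_add] at hE0 hE1 hE3 hF0 hF1 hF3
    have hE13 : α * β' + β * d' = 0 := by
      linear_combination r * hE1 + s * hE3 - (α * β' + β * d') * hrs
    have hF13 : c * β' + d * d' = 1 := by
      linear_combination r * hF1 + s * hF3 - (c * β' + d * d' - 1) * hrs
    have hdet : (α * d - β * c) * (α' * d' - β' * c') = 1 := by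
      linear_combination (c * β' + d * d') * hE0 + hF13 - (c * α' + d * c') * hE13
    -- reduction modulo `n`
    have he' : ∀ i, (((α • e + β • f') i : ℤ) : ZMod n) = e i := fun i => by
      rw [← hαβ, cast_vecMul_of_mem hγ]
    have hf'' : ∀ i, (((c • e + d • f') i : ℤ) : ZMod n) = f i := fun i => by
      rw [← hcd, cast_vecMul_of_mem hγ]
    have h0 := he' 0
    have h1 := he' 1
    have h3 := he' 3
    have h1' := hf'' 1
    have h3' := hf'' 3
    simp only [he, hf, hf', Pi.add_apply, Pi.smul_apply, smul_eq_mul, cons_val, mul_one, mul_zero,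
      add_zero, zero_add, Int.cast_mul, Int.cast_zero, Int.cast_one] at h0 h1 h3 h1' h3'
    have hβ : (β : ZMod n) = 0 := by
      have hq : (r' : ZMod n) * y' + s' * z' = 1 := by
        exact_mod_cast congrArg (Int.cast : ℤ → ZMod n) hrs'
      linear_combination r' * h1 + s' * h3 - β * hq
    rcases Int.eq_one_or_neg_one_of_mul_eq_one hdet with hd | hd <;>
      have hd' := congrArg (Int.cast : ℤ → ZMod n) hd <;>
      simp only [Int.cast_sub, Int.cast_mul, h0, hβ, one_mul, zero_mul, sub_zero, Int.cast_neg,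
        Int.cast_one] at hd' <;> rw [hd'] at h1' h3'
    · exact Or.inl (Prod.ext (by simpa using h1'.symm) (by simpa using h3'.symm))
    · exact Or.inr (Prod.ext (by simpa using h1'.symm) (by simpa using h3'.symm))
  · rintro (h | h)
    · exact exists_levelGroup_act_stdPlane ht hy hy' (congrArg Prod.fst h) (congrArg Prod.snd h)
    · obtain ⟨γ, hγ, hv⟩ := exists_levelGroup_act_stdPlane (n := n) ht hy (hy'.neg_neg)
        (by simpa using congrArg Prod.fst h) (by simpa using congrArg Prod.snd h)
      refine ⟨γ, hγ, hv.trans ?_⟩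
      have hneg : intVec ![0, -y', 0, -z'] = -intVec ![0, y', 0, z'] := by
        ext j
        fin_cases j <;> simp [intVec]
      rw [stdPlane, stdPlane, hneg, Submodule.span_insert, Submodule.span_insert,
        ← Set.neg_singleton, Submodule.span_neg]

/-- The standard line as an isotropic subspace. -/
def stdLineSubspace (t : ℕ) : IsotropicSubspace t :=
  lineOf ⟨![1, 0, 0, 0], hasDivisorOne_iff.2 ⟨1, 0, 0, 0, by simp⟩⟩

theorem coe_stdLineSubspace (t : ℕ) : (stdLineSubspace t).val = stdLine := rfl

theorem finrank_eq_one_or_two {p : ℕ} (hp : p.Prime) (U : IsotropicSubspace p) :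
    Module.finrank ℚ U.val = 1 ∨ Module.finrank ℚ U.val = 2 := by
  obtain ⟨e, -, h | h⟩ := exists_isSimilitude_map_eq (n := 1) hp U.2.1 U.2.2
  · exact Or.inl (by rw [h, LinearEquiv.finrank_map_eq, finrank_stdLine])
  · exact Or.inr (by rw [h, LinearEquiv.finrank_map_eq, finrank_stdPlane isCoprime_one_left])

/-- The neighbours of `⟨e₀⟩` are represented by the planes through `e₀`. -/
theorem neighborSet_stdLine {p : ℕ} (hp : p.Prime) (q : ℕ) :
    (titsBuilding p (levelGroup p q)).neighborSet
        (orbitOf p (levelGroup p q) (stdLineSubspace p)) =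
      (fun y => orbitOf p (levelGroup p q) (planeOf p y)) '' {y | IsCoprime y.1 y.2} := by
  ext x
  rw [SimpleGraph.mem_neighborSet, titsBuilding_adj_orbitOf_iff (levelGroup_le p q)]
  constructor
  · rintro ⟨hne, W, rfl, h⟩
    have hle : (stdLineSubspace p).val ≤ W.val := by
      rcases h with h | h
      · exact h
      · refine (Submodule.eq_of_le_of_finrank_le h ?_).ge
        rw [coe_stdLineSubspace, finrank_stdLine]
        rcases finrank_eq_one_or_two hp W with h | h <;> omega
    have hmem : intVec ![1, 0, 0, 0] ∈ W.val := hle (Submodule.mem_span_singleton_self _)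
    rcases eq_stdLine_or_eq_stdPlane hp.ne_zero W.2.1 hmem with h | ⟨y, z, hyz, h⟩
    · exact absurd (congrArg _ (Subtype.ext h).symm) hne
    · exact ⟨(y, z), hyz, congrArg _ (Subtype.ext h.symm)⟩
  · rintro ⟨y, hy, rfl⟩
    refine ⟨fun h => ?_, planeOf p y, rfl, Or.inl (stdLine_le_stdPlane y.1 y.2)⟩
    have := finrank_eq_of_orbitOf_eq h
    rw [coe_stdLineSubspace, coe_planeOf, finrank_stdLine, finrank_stdPlane hy] at this
    omega

theorem signCard_mul_ncard_neighborSet_stdLine {p q : ℕ} (hp : p.Prime) (hq : q.Prime) :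
    signCard q * ((titsBuilding p (levelGroup p q)).neighborSet
      (orbitOf p (levelGroup p q) (stdLineSubspace p))).ncard = q ^ 2 - 1 := by
  have : NeZero q := ⟨hq.ne_zero⟩
  have hone : ¬ q ∣ 1 := hq.one_lt.ne' ∘ Nat.dvd_one.1
  have himg : (fun y : ℤ × ℤ => ((y.1 : ZMod q), (y.2 : ZMod q))) '' {y | IsCoprime y.1 y.2} =
      admissible 1 q (ZMod q) := by
    ext ⟨x1, x2⟩
    constructor
    · rintro ⟨y, ⟨r, s, hrs⟩, h⟩
      have h' := congrArg (Int.cast : ℤ → ZMod q) hrs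
      rw [← h]
      have : Fact q.Prime := ⟨hq⟩
      by_contra hcon
      simp only [admissible, Set.mem_ofPred_eq, not_or, not_and, not_not] at hcon
      push_cast at h'
      rw [hcon.1, hcon.2 hone] at h'
      simp at h'
    · intro h
      obtain ⟨m, n, hmn, hm, hn⟩ := exists_isCoprime_lift hq one_ne_zero h
      exact ⟨(m, n), by simpa using hmn, Prod.ext hm hn⟩
  have hcount := ncard_admissible_of_not_dvd hone (ZMod q)
  rw [Nat.card_zmod] at hcount
  rw [neighborSet_stdLine hp, ← hcount, ← himg]
  refine (ncard_image_eq_mul (Set.toFinite _) ?_ ?_ ?_).symm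
  · intro y hy
    rw [himg]
    exact neg_mem_admissible (himg ▸ Set.mem_image_of_mem _ hy)
  · intro y hy
    have hmem := Set.mem_image_of_mem (fun y : ℤ × ℤ => ((y.1 : ZMod q), (y.2 : ZMod q))) hy
    rw [himg] at hmem
    exact ncard_pair_neg hq (ne_zero_of_mem_admissible hmem)
  · intro y hy y' hy'
    exact orbitOf_planeOf_eq_iff hp.ne_zero hy hy'

/-! ### The neighbours of the standard plane -/

theorem intVec_mem_stdPlane_one_zero_iff {u : Fin 4 → ℤ} :
    intVec u ∈ stdPlane 1 0 ↔ u 2 = 0 ∧ u 3 = 0 := by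
  constructor
  · intro h
    obtain ⟨a, b, hab⟩ := Submodule.mem_span_pair.1 h
    have h2 := congrFun hab 2
    have h3 := congrFun hab 3
    simp [intVec] at h2 h3
    exact_mod_cast And.intro h2.symm h3.symm
  · rintro ⟨h2, h3⟩
    refine Submodule.mem_span_pair.2 ⟨u 0, u 1, ?_⟩
    ext j
    fin_cases j <;> simp [intVec, h2, h3]

/-- The neighbours of `⟨e₀, e₁⟩` are the lines in it: those of divisor one and, as the swap preserves
this plane, the swaps of those. -/
theorem neighborSet_stdPlane {p : ℕ} (hp : p.Prime) (q : ℕ) :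
    (titsBuilding p (levelGroup p q)).neighborSet
        (orbitOf p (levelGroup p q) (planeOf p (1, 0))) =
      (fun v => orbitOf p (levelGroup p q) (lineOf v)) '' {v | v.val 2 = 0 ∧ v.val 3 = 0} ∪
        swapOrbit hp q ''
          ((fun v => orbitOf p (levelGroup p q) (lineOf v)) '' {v | v.val 2 = 0 ∧ v.val 3 = 0}) := by
  have hdim : Module.finrank ℚ (planeOf p (1, 0)).val = 2 := finrank_stdPlane isCoprime_one_left
  ext x
  rw [SimpleGraph.mem_neighborSet, titsBuilding_adj_orbitOf_iff (levelGroup_le p q)]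
  constructor
  · rintro ⟨hne, W, rfl, h⟩
    have hW : W.val ≤ (planeOf p (1, 0)).val ∧ Module.finrank ℚ W.val = 1 := by
      have hWne : W.val ≠ (planeOf p (1, 0)).val :=
        fun h => hne (congrArg _ (Subtype.ext h.symm))
      rcases finrank_eq_one_or_two hp W with hr | hr <;> rcases h with h | h
      · have := Submodule.finrank_mono h
        omega
      · exact ⟨h, hr⟩
      · exact absurd (Submodule.eq_of_le_of_finrank_eq h (hdim.trans hr.symm)).symm hWne
      · exact absurd (Submodule.eq_of_le_of_finrank_eq h (hr.trans hdim.symm)) hWne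
    obtain ⟨v, rfl | rfl⟩ := exists_lineOf_eq_or_swap hp hW.2
    · exact Or.inl ⟨v, intVec_mem_stdPlane_one_zero_iff.1
        (hW.1 (Submodule.mem_span_singleton_self _)), rfl⟩
    · refine Or.inr ⟨_, ⟨v, ?_, rfl⟩, rfl⟩
      have h := hW.1
      rw [coe_swapSubspace_lineOf] at h
      have := intVec_mem_stdPlane_one_zero_iff.1 (h (Submodule.mem_span_singleton_self _))
      simp [hp.ne_zero] at this
      exact ⟨this.2, this.1⟩
  · have key : ∀ W : IsotropicSubspace p, Module.finrank ℚ W.val = 1 →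
        W.val ≤ (planeOf p (1, 0)).val →
        orbitOf p (levelGroup p q) (planeOf p (1, 0)) ≠ orbitOf p (levelGroup p q) W ∧
          ∃ W' : IsotropicSubspace p, orbitOf p (levelGroup p q) W' = orbitOf p (levelGroup p q) W ∧
            ((planeOf p (1, 0)).val ≤ W'.val ∨ W'.val ≤ (planeOf p (1, 0)).val) := by
      intro W hW hle
      refine ⟨fun h => ?_, W, rfl, Or.inr hle⟩
      have := finrank_eq_of_orbitOf_eq h
      omega
    rintro (⟨v, hv, rfl⟩ | ⟨_, ⟨v, hv, rfl⟩, rfl⟩)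
    · refine key _ (finrank_lineOf v) ?_
      exact (Submodule.span_singleton_le_iff_mem _ _).2 (intVec_mem_stdPlane_one_zero_iff.2 hv)
    · refine key (swapSubspace hp (lineOf v)) (by rw [finrank_swapSubspace, finrank_lineOf]) ?_
      rw [coe_swapSubspace_lineOf, Submodule.span_singleton_le_iff_mem]
      exact intVec_mem_stdPlane_one_zero_iff.2 (by simpa using ⟨Or.inr hv.2, hv.1⟩)

theorem signCard_mul_ncard_lineOf_stdPlane {p q : ℕ} (hp : p.Prime) (hq : q.Prime) :
    signCard q * ((fun v : {v : Fin 4 → ℤ // HasDivisorOne p v} =>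
      orbitOf p (levelGroup p q) (lineOf v)) '' {v | v.val 2 = 0 ∧ v.val 3 = 0}).ncard =
        (admissible p q (ZMod q)).ncard := by
  have : NeZero q := ⟨hq.ne_zero⟩
  have himg : (fun v : {v : Fin 4 → ℤ // HasDivisorOne p v} =>
      ((v.val 0 : ZMod q), (v.val 1 : ZMod q))) '' {v | v.val 2 = 0 ∧ v.val 3 = 0} =
      admissible p q (ZMod q) := by
    ext ⟨x0, x1⟩
    constructor
    · rintro ⟨v, ⟨h2, h3⟩, h⟩
      have := mem_admissible_of_hasDivisorOne hq v.2
      rw [← h]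
      simpa [admissible, h2, h3] using this
    · intro h
      obtain ⟨m, n, ⟨r, s, hrs⟩, hm, hn⟩ := exists_isCoprime_lift hq hp.ne_zero h
      refine ⟨⟨![m, n, 0, 0], hasDivisorOne_iff.2 ⟨r, 0, s, 0, ?_⟩⟩, by simp, by simp [hm, hn]⟩
      simp
      linarith
  rw [← himg]
  refine (ncard_image_eq_mul (Set.toFinite _) ?_ ?_ ?_).symm
  · intro y hy
    rw [himg]
    exact neg_mem_admissible (himg ▸ Set.mem_image_of_mem _ hy)
  · intro v hv
    have hmem := Set.mem_image_of_mem (fun v : {v : Fin 4 → ℤ // HasDivisorOne p v} =>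
      ((v.val 0 : ZMod q), (v.val 1 : ZMod q))) hv
    rw [himg] at hmem
    exact ncard_pair_neg hq (ne_zero_of_mem_admissible hmem)
  · rintro v ⟨hv2, hv3⟩ w ⟨hw2, hw3⟩
    rw [orbitOf_lineOf_eq_iff hp.two_le]
    simp [Fin.forall_fin_succ, hv2, hv3, hw2, hw3]

/-! ### The configuration -/

theorem bipartite_titsBuilding {p : ℕ} (hp : p.Prime) (q : ℕ) :
    (titsBuilding p (levelGroup p q)).IsBipartiteWith (lineOrbits p (levelGroup p q))
      (planeOrbits p (levelGroup p q)) where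
  disjoint := by
    rw [Set.disjoint_left]
    rintro x ⟨U, rfl, hU⟩ ⟨W, hW, hW2⟩
    have := finrank_eq_of_orbitOf_eq hW
    omega
  mem_of_adj := by
    intro x y hxy
    induction x using Quotient.inductionOn with | h U => ?_
    obtain ⟨hne, W, rfl, h⟩ :=
      (titsBuilding_adj_orbitOf_iff (U := U) (levelGroup_le p q)).1 hxy
    have hUW : U.val ≠ W.val := fun h => hne (congrArg _ (Subtype.ext h))
    have hrank : Module.finrank ℚ U.val ≠ Module.finrank ℚ W.val := fun hr =>
      h.elim (fun h => hUW (Submodule.eq_of_le_of_finrank_eq h hr))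
        (fun h => hUW (Submodule.eq_of_le_of_finrank_eq h hr.symm).symm)
    rcases finrank_eq_one_or_two hp U with hU | hU <;>
      rcases finrank_eq_one_or_two hp W with hW | hW
    · omega
    · exact Or.inl ⟨⟨U, rfl, hU⟩, ⟨W, rfl, hW⟩⟩
    · exact Or.inr ⟨⟨U, rfl, hU⟩, ⟨W, rfl, hW⟩⟩
    · omega

/-- Double counting of the edges of a biregular bipartite graph. -/
theorem ncard_mul_eq_ncard_mul {V : Type*} {G : SimpleGraph V} {P B : Set V}
    (h : G.IsBipartiteWith P B) (hP : P.Finite) {b d : ℕ} (hb0 : b ≠ 0) (hd0 : d ≠ 0)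
    (hb : ∀ x ∈ P, (G.neighborSet x).ncard = b) (hd : ∀ y ∈ B, (G.neighborSet y).ncard = d) :
    P.ncard * b = B.ncard * d := by
  classical
  have hB : B.Finite := by
    refine (hP.biUnion fun x hx => Set.finite_of_ncard_ne_zero
      ((hb x hx).trans_ne hb0)).subset fun y hy => ?_
    obtain ⟨x, hx⟩ := Set.nonempty_of_ncard_ne_zero ((hd y hy).trans_ne hd0)
    exact Set.mem_biUnion (h.symm.mem_of_mem_adj hy hx) hx.symm
  have key := Finset.sum_card_bipartiteAbove_eq_sum_card_bipartiteBelow (s := hP.toFinset)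
    (t := hB.toFinset) G.Adj
  rw [Finset.sum_const_nat (m := b), Finset.sum_const_nat (m := d)] at key
  · rwa [Set.ncard_eq_toFinset_card P hP, Set.ncard_eq_toFinset_card B hB]
  · intro y hy
    rw [← hd y (hB.mem_toFinset.1 hy), SimpleGraph.isBipartiteWith_neighborSet h.symm
      (hB.mem_toFinset.1 hy), ← Set.ncard_coe_finset]
    congr 1
    ext x
    simp [Finset.bipartiteBelow, G.adj_comm]
  · intro x hx
    rw [← hb x (hP.mem_toFinset.1 hx), SimpleGraph.isBipartiteWith_neighborSet h
      (hP.mem_toFinset.1 hx), ← Set.ncard_coe_finset]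
    congr 1
    ext x
    simp [Finset.bipartiteAbove]

/-- The configuration, with the number of planes determined by double counting. -/
theorem isConfiguration_of_counts {p q s s' b c : ℕ} (hp : p.Prime) (hq : q.Prime)
    (hs : (admissible p q (ZMod q × ZMod q)).ncard = signCard q * s)
    (hs' : (admissible p q (ZMod q)).ncard = signCard q * s')
    (hb : q ^ 2 - 1 = signCard q * b) (hs0 : s ≠ 0) (hs0' : s' ≠ 0) (hb0 : b ≠ 0)
    (hc : s * b = c * s') :
    (planeOrbits p (levelGroup p q)).ncard = c ∧
      IsConfiguration (titsBuilding p (levelGroup p q)) (lineOrbits p (levelGroup p q))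
        (planeOrbits p (levelGroup p q)) (2 * s) b c (2 * s') := by
  have hk : 0 < signCard q := by unfold signCard; split_ifs <;> omega
  have hs1 := Nat.eq_of_mul_eq_mul_left hk ((signCard_mul_ncard_lineOf hp hq).trans hs)
  have hs1' := Nat.eq_of_mul_eq_mul_left hk ((signCard_mul_ncard_lineOf_stdPlane hp hq).trans hs')
  have hb1 :=
    Nat.eq_of_mul_eq_mul_left hk ((signCard_mul_ncard_neighborSet_stdLine hp hq).trans hb)
  have ha : (lineOrbits p (levelGroup p q)).ncard = 2 * s := by
    rw [lineOrbits_eq hp, ncard_union_swapOrbit hp q rfl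
      (Set.finite_of_ncard_ne_zero (hs1.trans_ne hs0)), hs1]
  have hlines : ∀ x ∈ lineOrbits p (levelGroup p q),
      ((titsBuilding p (levelGroup p q)).neighborSet x).ncard = b := by
    rintro _ ⟨U, rfl, hU⟩
    obtain ⟨e, he, h | h⟩ := exists_isSimilitude_map_eq (n := q) hp U.2.1 U.2.2
    · have : U = he.subspaceEquiv (stdLineSubspace p) := Subtype.ext h
      rw [this, ← he.orbitEquiv_orbitOf, he.ncard_neighborSet (levelGroup_le p q), hb1]
    · rw [h, LinearEquiv.finrank_map_eq, finrank_stdPlane isCoprime_one_left] at hU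
      omega
  have hplanes : ∀ x ∈ planeOrbits p (levelGroup p q),
      ((titsBuilding p (levelGroup p q)).neighborSet x).ncard = 2 * s' := by
    rintro _ ⟨U, rfl, hU⟩
    obtain ⟨e, he, h | h⟩ := exists_isSimilitude_map_eq (n := q) hp U.2.1 U.2.2
    · rw [h, LinearEquiv.finrank_map_eq, finrank_stdLine] at hU
      omega
    · have : U = he.subspaceEquiv (planeOf p (1, 0)) := Subtype.ext h
      rw [this, ← he.orbitEquiv_orbitOf, he.ncard_neighborSet (levelGroup_le p q),
        neighborSet_stdPlane hp, ncard_union_swapOrbit hp q rfl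
        (Set.finite_of_ncard_ne_zero (hs1'.trans_ne hs0')), hs1']
  have hcount : (planeOrbits p (levelGroup p q)).ncard = c := by
    have h := ncard_mul_eq_ncard_mul (bipartite_titsBuilding hp q)
      (Set.finite_of_ncard_ne_zero (ha.trans_ne (by omega))) hb0 (by omega) hlines hplanes
    rw [ha] at h
    refine Nat.eq_of_mul_eq_mul_right (Nat.pos_of_ne_zero hs0') ?_
    linarith
  refine ⟨hcount, bipartite_titsBuilding hp q, ?_, ha, hlines, hcount, hplanes⟩
  refine Set.eq_univ_of_forall fun x => ?_
  induction x using Quotient.inductionOn with | h U => ?_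
  exact (finrank_eq_one_or_two hp U).imp (fun h => ⟨U, rfl, h⟩) fun h => ⟨U, rfl, h⟩

end SiegelTits

theorem mainTheorem8 (p q : ℕ) (hp : p.Prime) (hq : q.Prime) (hp3 : 3 ≤ p) :
    (q ≠ p → q ≠ 2 →
      (SiegelTits.planeOrbits p (SiegelTits.levelGroup p q)).ncard = (q ^ 4 - 1) / 2 ∧
      SiegelTits.IsConfiguration
        (SiegelTits.titsBuilding p (SiegelTits.levelGroup p q))
        (SiegelTits.lineOrbits p (SiegelTits.levelGroup p q))
        (SiegelTits.planeOrbits p (SiegelTits.levelGroup p q))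
        (q ^ 4 - 1) ((q ^ 2 - 1) / 2) ((q ^ 4 - 1) / 2) (q ^ 2 - 1)) ∧
    (q = p →
      (SiegelTits.planeOrbits p (SiegelTits.levelGroup p q)).ncard =
        (q ^ 2 - 1) * (q ^ 2 + q) / 2 ∧
      SiegelTits.IsConfiguration
        (SiegelTits.titsBuilding p (SiegelTits.levelGroup p q))
        (SiegelTits.lineOrbits p (SiegelTits.levelGroup p q))
        (SiegelTits.planeOrbits p (SiegelTits.levelGroup p q))
        (q ^ 4 - q ^ 2) ((q ^ 2 - 1) / 2) ((q ^ 2 - 1) * (q ^ 2 + q) / 2) (q ^ 2 - q)) ∧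
    (q = 2 →
      (SiegelTits.planeOrbits p (SiegelTits.levelGroup p q)).ncard = 15 ∧
      SiegelTits.IsConfiguration
        (SiegelTits.titsBuilding p (SiegelTits.levelGroup p q))
        (SiegelTits.lineOrbits p (SiegelTits.levelGroup p q))
        (SiegelTits.planeOrbits p (SiegelTits.levelGroup p q))
        30 3 15 6) := by
  have hdvd : q ≠ p → ¬ q ∣ p := fun h hd => h ((Nat.prime_dvd_prime_iff_eq hq hp).1 hd)
  have hq2 : Nat.card (ZMod q × ZMod q) = q ^ 2 := by rw [Nat.card_prod, Nat.card_zmod, sq]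
  have hq1 : Nat.card (ZMod q) = q := Nat.card_zmod q
  have : NeZero q := ⟨hq.ne_zero⟩
  refine ⟨fun hqp h2 => ?_, fun hqp => ?_, fun h2 => ?_⟩
  · obtain ⟨m, rfl⟩ := hq.odd_of_ne_two h2
    have hm : 0 < m := Nat.pos_of_ne_zero fun h => by simp [h, Nat.not_prime_one] at hq
    -- `q² = 2 B + 1`
    obtain ⟨B, hB⟩ : ∃ B, B = 2 * m ^ 2 + 2 * m := ⟨_, rfl⟩
    have e2 : (2 * m + 1) ^ 2 = 2 * B + 1 := by rw [hB]; ring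
    have e4 : (2 * m + 1) ^ 4 = 2 * (2 * B ^ 2 + 2 * B) + 1 := by rw [hB]; ring
    have hB0 : 0 < B := by rw [hB]; positivity
    have key := SiegelTits.isConfiguration_of_counts hp hq (s := 2 * B ^ 2 + 2 * B) (s' := B)
      (b := B) (c := 2 * B ^ 2 + 2 * B)
      (by rw [SiegelTits.ncard_admissible_of_not_dvd (hdvd hqp), hq2, ← pow_mul, e4]
          simp [SiegelTits.signCard, h2])
      (by rw [SiegelTits.ncard_admissible_of_not_dvd (hdvd hqp), hq1, e2]
          simp [SiegelTits.signCard, h2])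
      (by rw [e2]; simp [SiegelTits.signCard, h2])
      (by positivity) hB0.ne' hB0.ne' rfl
    convert key using 2 <;> omega
  · have h2 : q ≠ 2 := by omega
    obtain ⟨m, hm⟩ := hq.odd_of_ne_two h2
    have hm0 : 0 < m := by have := hq.two_le; omega
    -- `q² = 2 B + 1`
    obtain ⟨B, hB⟩ : ∃ B, B = 2 * m ^ 2 + 2 * m := ⟨_, rfl⟩
    have e2 : q ^ 2 = 2 * B + 1 := by rw [hB, hm]; ring
    have e2' : q ^ 2 = 2 * (m * q) + q := by rw [hm]; ring
    have e4 : q ^ 4 = 2 * (q ^ 2 * B) + q ^ 2 := by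
      calc q ^ 4 = q ^ 2 * q ^ 2 := by ring
        _ = q ^ 2 * (2 * B + 1) := by rw [← e2]
        _ = _ := by ring
    have hB0 : 0 < B := by rw [hB]; positivity
    have hq0 := hq.pos
    have key := SiegelTits.isConfiguration_of_counts hp hq (s := q ^ 2 * B) (s' := m * q)
      (b := B) (c := B * (q ^ 2 + q))
      (by rw [SiegelTits.ncard_admissible_of_dvd hqp.dvd, hq2, ← pow_mul, e4]
          simp [SiegelTits.signCard, h2])
      (by rw [SiegelTits.ncard_admissible_of_dvd hqp.dvd, hq1, e2']
          simp [SiegelTits.signCard, h2])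
      (by rw [e2]; simp [SiegelTits.signCard, h2])
      (by positivity) (by positivity) hB0.ne' (by rw [hB, hm]; ring)
    have ec : (q ^ 2 - 1) * (q ^ 2 + q) / 2 = B * (q ^ 2 + q) := by
      have : q ^ 2 - 1 = 2 * B := by omega
      rw [this, mul_assoc, Nat.mul_div_cancel_left _ two_pos]
    rw [ec]
    convert key using 2 <;> omega
  · subst h2
    have hnd := hdvd (by omega)
    exact SiegelTits.isConfiguration_of_counts hp hq (s := 15) (s' := 3) (b := 3) (c := 15)
      (by rw [SiegelTits.ncard_admissible_of_not_dvd hnd, hq2]; simp [SiegelTits.signCard])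
      (by rw [SiegelTits.ncard_admissible_of_not_dvd hnd, hq1]; simp [SiegelTits.signCard])
      (by simp [SiegelTits.signCard]) (by norm_num) (by norm_num) (by norm_num) (by norm_num)
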